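/- Let $V$ be a vertex operator algebra over $\mathbb{C}$. A vector $u\in V$ is a \emph{rational semisimple primary vector} if (i) $L(n)u=\delta_{n,0}u$ for all $n\ge 0$; (ii) there is $\gamma\in\mathbb{Q}$ with $u_{(m)}u=\delta_{m,1}\gamma\mathbf{1}$ for all $m\ge 0$; (iii) $u_{(0)}$ acts semisimply on $V$; and all eigenvalues of $u_{(0)}$ on $V$ lie in $\frac1T\mathbb{Z}$ for some nonzero integer $T$. For such $u$ put $\sigma(u)=\exp(-2\pi i\,u_{(0)})\in\mathrm{Aut}(V)$ and $$\Delta(u,z)=z^{u_{(0)}}\exp\Big(-\sum_{n\ge 1}\frac{u_{(n)}}{n}(-z)^{-n}\Big).$$ For an automorphism $g$ of $V$ of finite order, an \emph{irreducible $g$-twisted $V$-module} means a nonzero weak $g$-twisted $V$-module $(W,Y_W)$ (no grading is required) whose only subspaces invariant under all modes $a_{(n)}$ ($a\in V$, $n\in\frac1{|g|}\mathbb{Z}$) are $0$ and $W$. Here $Y_W(a,z)=\sum_{n} a_{(n)}z^{-n-1}$ has exponents $n\in\frac{r}{|g|}+\mathbb{Z}$ when $ga=e^{2\pi i r/|g|}a$,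 is truncated ($a_{(n)}w=0$ for $n\gg0$), satisfies $Y_W(\mathbf{1},z)=\mathrm{id}_W$, and satisfies the $g$-twisted Jacobi identity. For an automorphism $h$ of $V$, such a module $W$ is \emph{$h$-stable} if there is a linear automorphism $\phi$ of $W$ with $\phi\,Y_W(a,z)=Y_W(ha,z)\,\phi$ for all $a\in V$. \textbf{Proposition.} Let $u$ be a rational semisimple primary vector of $V$ and let $g$ be an automorphism of $V$ of finite order with $gu=u$. Then $g\sigma(u)$ is an automorphism of finite order, and $$(W,\,Y_W(\cdot,z))\longmapsto (W,\,Y_W(\Delta(u,z)\,\cdot,z))$$ induces a bijection from the set of isomorphism classes of irreducible $g$-twisted $V$-modules onto the set of isomorphism classes of irreducible $g\sigma(u)$-twisted $V$-modules. Moreover, if $h$ is an automorphism of $V$ with $gh=hg$ and $hu=u$, then this bijection restricts to a bijection from the classes of $h$-stable irreducible $g$-twisted $V$-modules onto the classes of $h$-stable irreducible $g\sigma(u)$-twisted $V$-modules. -/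

import Mathlib

universe v w

noncomputable section

open scoped VertexOperator Nat

/-- A vertex operator algebra structure on a complex vector space `V`. The operator
`(Y a)[[n]]` is the mode `a_(n)`, i.e. `Y(a,z) = ∑ a_(n) z^{-n-1}`; that `Y(a,z)b` is a Laurent
series is part of `VertexOperator ℂ V`. -/
structure VertexOperatorAlgebra (V : Type v) [AddCommGroup V] [Module ℂ V] where
  /-- The state-field correspondence. -/
  Y : V →ₗ[ℂ] VertexOperator ℂ V
  /-- The vacuum vector. -/
  vacuum : V
  /-- The conformal (Virasoro) vector. -/
  conformal : V
  /-- The central charge. -/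
  centralCharge : ℂ
  vacuum_mode : ∀ (n : ℤ) (b : V), ((Y vacuum)[[n]]) b = if n = -1 then b else 0
  creation : ∀ a : V, ((Y a)[[-1]]) vacuum = a
  creation_regular : ∀ (a : V) (n : ℤ), 0 ≤ n → ((Y a)[[n]]) vacuum = 0
  /-- The Jacobi identity: the coefficient of `z₀^{-l-1} z₁^{-m-1} z₂^{-n-1}`. -/
  jacobi : ∀ (a b c : V) (l m n : ℤ),
    ∑ᶠ i : ℕ, ((-1 : ℂ) ^ i * (Ring.choose l i : ℤ)) •
        (((Y a)[[m + l - i]]) (((Y b)[[n + i]]) c)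
          - ((-1 : ℂ) ^ l) • ((Y b)[[n + l - i]]) (((Y a)[[m + i]]) c))
      = ∑ᶠ i : ℕ, ((Ring.choose m i : ℤ) : ℂ) • ((Y (((Y a)[[l + i]]) b))[[m + n - i]]) c
  /-- The Virasoro relations for `L(n) = ω_(n+1)`. -/
  virasoro : ∀ (m n : ℤ) (a : V),
    ((Y conformal)[[m + 1]]) (((Y conformal)[[n + 1]]) a)
        - ((Y conformal)[[n + 1]]) (((Y conformal)[[m + 1]]) a)
      = ((m : ℂ) - n) • ((Y conformal)[[m + n + 1]]) a
        + (if m + n = 0 then ((m : ℂ) ^ 3 - m) / 12 * centralCharge else 0) • a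
  /-- `Y(L(-1)a,z) = d/dz Y(a,z)`. -/
  translation : ∀ (a b : V) (n : ℤ),
    ((Y (((Y conformal)[[0]]) a))[[n]]) b = (-(n : ℂ)) • ((Y a)[[n - 1]]) b
  /-- `V` is the direct sum of its weight spaces `V_n`, the `n`-eigenspaces of `L(0)`, `n ∈ ℤ`. -/
  weight_decomposition :
    DirectSum.IsInternal fun n : ℤ => Module.End.eigenspace ((Y conformal)[[1]]) (n : ℂ)
  weight_finite : ∀ n : ℤ,
    Module.Finite ℂ (Module.End.eigenspace ((Y conformal)[[1]]) (n : ℂ))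
  weight_bounded : ∃ N : ℤ, ∀ n < N, Module.End.eigenspace ((Y conformal)[[1]]) (n : ℂ) = ⊥

namespace VertexOperatorAlgebra

variable {V : Type v} [AddCommGroup V] [Module ℂ V] (A : VertexOperatorAlgebra V)

/-- The mode `a_(n)` of `a` on `V`. -/
def mode (a : V) (n : ℤ) : Module.End ℂ V := (A.Y a)[[n]]

/-- The Virasoro operators `L(n) = ω_(n+1)` on `V`. -/
def L (n : ℤ) : Module.End ℂ V := A.mode A.conformal (n + 1)

/-- The group of automorphisms of the vertex operator algebra. -/
def aut : Subgroup (V ≃ₗ[ℂ] V) where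
  carrier := {g | g A.vacuum = A.vacuum ∧ g A.conformal = A.conformal ∧
    ∀ (a b : V) (n : ℤ), g (A.mode a n b) = A.mode (g a) n (g b)}
  mul_mem' := by
    rintro g h ⟨g1, g2, g3⟩ ⟨h1, h2, h3⟩
    refine ⟨?_, ?_, ?_⟩ <;> simp [*]
  one_mem' := by simp
  inv_mem' := by
    rintro g ⟨g1, g2, g3⟩
    refine ⟨?_, ?_, fun a b n => ?_⟩
    · exact (LinearEquiv.symm_apply_eq g).2 g1.symm
    · exact (LinearEquiv.symm_apply_eq g).2 g2.symm
    · refine (LinearEquiv.symm_apply_eq g).2 ?_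
      rw [g3]
      exact congr_arg₂ (fun x y => A.mode x n y) (g.apply_symm_apply a).symm
        (g.apply_symm_apply b).symm

/-- `u` is a semisimple primary vector: a primary vector of weight one with
`u_(m)u = δ_{m,1} γ 𝟙` for `m ≥ 0` with `γ` rational, such that `u_(0)` acts semisimply. -/
structure IsSemisimplePrimary (u : V) : Prop where
  L_zero : A.L 0 u = u
  L_pos : ∀ n : ℤ, 0 < n → A.L n u = 0
  self_mode : ∃ γ : ℚ, ∀ m : ℤ, 0 ≤ m →
    A.mode u m u = if m = 1 then (γ : ℂ) • A.vacuum else 0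
  semisimple : ⨆ μ : ℂ, (A.mode u 0).eigenspace μ = ⊤

/-- A semisimple primary vector `u` is rational if all eigenvalues of `u_(0)` on `V` lie in
`(1/T)ℤ` for some nonzero integer `T`. -/
structure IsRationalSemisimplePrimary (u : V) : Prop extends A.IsSemisimplePrimary u where
  rational : ∃ T : ℤ, T ≠ 0 ∧
    ∀ μ : ℂ, (A.mode u 0).HasEigenvalue μ → ∃ k : ℤ, μ = (k : ℂ) / T

/-- The eigenspace of `u_(0)` with rational eigenvalue `r`. -/
def chargeSpace (u : V) (r : ℚ) : Submodule ℂ V := (A.mode u 0).eigenspace (r : ℂ)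

variable {A}

theorem IsRationalSemisimplePrimary.isInternal {u : V} (hu : A.IsRationalSemisimplePrimary u) :
    DirectSum.IsInternal (A.chargeSpace u) := by
  rw [DirectSum.isInternal_submodule_iff_iSupIndep_and_iSup_eq_top]
  constructor
  · exact (Module.End.eigenspaces_iSupIndep (A.mode u 0)).comp
      (f := fun r : ℚ => (r : ℂ)) Rat.cast_injective
  · rw [eq_top_iff, ← hu.semisimple]
    refine iSup_le fun μ => ?_
    by_cases hμ : (A.mode u 0).HasEigenvalue μ
    · obtain ⟨T, hT, h⟩ := hu.rational
      obtain ⟨k, rfl⟩ := h μ hμ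
      refine le_trans (le_of_eq ?_) (le_iSup _ ((k : ℚ) / T))
      simp [chargeSpace]
    · rw [Module.End.hasEigenvalue_iff, not_not] at hμ
      simp [hμ]

/-- The decomposition of `V` into eigenspaces of `u_(0)`. -/
def chargeEquiv {u : V} (hu : A.IsRationalSemisimplePrimary u) :
    (DirectSum ℚ fun r => A.chargeSpace u r) ≃ₗ[ℂ] V :=
  LinearEquiv.ofBijective (DirectSum.coeLinearMap (A.chargeSpace u)) hu.isInternal

/-- The projection of `V` onto the `r`-eigenspace of `u_(0)` along the other eigenspaces. -/
def chargeProj {u : V} (hu : A.IsRationalSemisimplePrimary u) (r : ℚ) : Module.End ℂ V :=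
  (A.chargeSpace u r).subtype ∘ₗ DirectSum.component ℂ ℚ (fun r => A.chargeSpace u r) r ∘ₗ
    (chargeEquiv hu).symm.toLinearMap

/-- The operator `exp(-2πi u_(0))`: on the `r`-eigenspace of the diagonalizable operator `u_(0)`
it is multiplication by `exp(-2πi r)`. -/
def sigmaEquiv {u : V} (hu : A.IsRationalSemisimplePrimary u) : V ≃ₗ[ℂ] V :=
  (chargeEquiv hu).symm ≪≫ₗ
    DFinsupp.mapRange.linearEquiv (fun r : ℚ => LinearEquiv.smulOfNeZero ℂ (A.chargeSpace u r)
      (Complex.exp (-(2 * Real.pi * Complex.I * (r : ℂ)))) (Complex.exp_ne_zero _)) ≪≫ₗ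
    chargeEquiv hu

theorem sigmaEquiv_apply_of_mem {u : V} (hu : A.IsRationalSemisimplePrimary u) {r : ℚ} {a : V}
    (ha : a ∈ A.chargeSpace u r) :
    sigmaEquiv hu a = Complex.exp (-(2 * Real.pi * Complex.I * (r : ℂ))) • a := by
  have h1 : (chargeEquiv hu).symm a
      = DirectSum.lof ℂ ℚ (fun r => A.chargeSpace u r) r ⟨a, ha⟩ := by
    rw [LinearEquiv.symm_apply_eq]
    exact (DirectSum.coeLinearMap_lof (A.chargeSpace u) r ⟨a, ha⟩).symm
  simp only [sigmaEquiv, LinearEquiv.trans_apply, h1, DirectSum.lof_eq_of]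
  have h2 : (DFinsupp.mapRange.linearEquiv
      (fun r : ℚ => LinearEquiv.smulOfNeZero ℂ (A.chargeSpace u r)
      (Complex.exp (-(2 * Real.pi * Complex.I * (r : ℂ)))) (Complex.exp_ne_zero _)))
      (DirectSum.of (fun r => A.chargeSpace u r) r ⟨a, ha⟩)
      = DirectSum.of (fun r => A.chargeSpace u r) r
        (Complex.exp (-(2 * Real.pi * Complex.I * (r : ℂ))) • ⟨a, ha⟩) := by
    exact DFinsupp.mapRange_single (hf := fun _ => map_zero _)
  rw [h2]
  exact DirectSum.coeLinearMap_of (A.chargeSpace u) r _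

/-- The commutator formula `[a_(m), b_(n)] = ∑ (m choose i) (a_(i) b)_(m+n-i)`. -/
theorem mode_commutator (a b c : V) (m n : ℤ) :
    A.mode a m (A.mode b n c) - A.mode b n (A.mode a m c)
      = ∑ᶠ i : ℕ, ((Ring.choose m i : ℤ) : ℂ) • A.mode (A.mode a i b) (m + n - i) c := by
  have h := A.jacobi a b c 0 m n
  rw [finsum_eq_single _ 0] at h
  · simpa [mode] using h
  · intro i hi
    simp [Ring.choose_zero_pos ℤ (Nat.pos_of_ne_zero hi)]

theorem mode_zero_derivation (u b c : V) (n : ℤ) :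
    A.mode u 0 (A.mode b n c) = A.mode (A.mode u 0 b) n c + A.mode b n (A.mode u 0 c) := by
  have h := mode_commutator (A := A) u b c 0 n
  rw [finsum_eq_single _ 0] at h
  · rw [← sub_eq_iff_eq_add]
    simpa using h
  · intro i hi
    simp [Ring.choose_zero_pos ℤ (Nat.pos_of_ne_zero hi)]

theorem mode_mem_chargeSpace {u a b : V} {r s : ℚ} (ha : a ∈ A.chargeSpace u r)
    (hb : b ∈ A.chargeSpace u s) (n : ℤ) : A.mode a n b ∈ A.chargeSpace u (r + s) := by
  rw [chargeSpace, Module.End.mem_eigenspace_iff] at *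
  rw [mode_zero_derivation, ha, hb]
  simp [mode, add_smul]

theorem vacuum_mem_chargeSpace (u : V) : A.vacuum ∈ A.chargeSpace u 0 := by
  rw [chargeSpace, Module.End.mem_eigenspace_iff]
  simpa [mode] using A.creation_regular u 0 le_rfl

theorem conformal_mem_chargeSpace {u : V} (hu : A.IsRationalSemisimplePrimary u) :
    A.conformal ∈ A.chargeSpace u 0 := by
  have h := mode_commutator (A := A) A.conformal u A.vacuum (-1) 0
  have hz : ∀ i : ℕ, i ∉ ({0, 1} : Finset ℕ) →
      ((Ring.choose (-1 : ℤ) i : ℤ) : ℂ) • A.mode (A.mode A.conformal i u) (-1 + 0 - i) A.vacuum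
        = 0 := by
    intro i hi
    simp only [Finset.mem_insert, Finset.mem_singleton, not_or] at hi
    have := hu.L_pos ((i : ℤ) - 1) (by omega)
    simp only [L, sub_add_cancel] at this
    rw [this]
    simp [mode]
  rw [finsum_eq_sum_of_support_subset (s := {0, 1}) _ (by
    intro i hi
    by_contra hc
    exact hi (hz i hc))] at h
  have h0 := hu.L_zero
  simp only [L, zero_add] at h0
  have ht := A.translation u A.vacuum (-1)
  have hv : A.mode u 0 A.vacuum = 0 := A.creation_regular u 0 le_rfl
  have hc : A.mode A.conformal (-1) A.vacuum = A.conformal := A.creation _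
  rw [Finset.sum_pair (by norm_num)] at h
  simp [hv, hc, h0] at h
  rw [chargeSpace, Module.End.mem_eigenspace_iff]
  have ht' : A.mode (A.mode A.conformal 0 u) (-1) A.vacuum = A.mode u (-2) A.vacuum := by
    simpa [mode] using ht
  rw [ht'] at h
  simpa using h

theorem sigmaEquiv_mem_aut {u : V} (hu : A.IsRationalSemisimplePrimary u) :
    sigmaEquiv hu ∈ A.aut := by
  have htop : ⨆ r, A.chargeSpace u r = ⊤ := hu.isInternal.submodule_iSup_eq_top
  refine ⟨?_, ?_, fun a b n => ?_⟩
  · simpa using sigmaEquiv_apply_of_mem hu (vacuum_mem_chargeSpace u)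
  · simpa using sigmaEquiv_apply_of_mem hu (conformal_mem_chargeSpace hu)
  · have ha : a ∈ ⨆ r, A.chargeSpace u r := htop ▸ Submodule.mem_top
    have hb : b ∈ ⨆ r, A.chargeSpace u r := htop ▸ Submodule.mem_top
    refine Submodule.iSup_induction _ (motive := fun a =>
      sigmaEquiv hu (A.mode a n b) = A.mode (sigmaEquiv hu a) n (sigmaEquiv hu b)) ha ?_ ?_ ?_
    · intro r a ha
      refine Submodule.iSup_induction _ (motive := fun b =>
        sigmaEquiv hu (A.mode a n b) = A.mode (sigmaEquiv hu a) n (sigmaEquiv hu b)) hb ?_ ?_ ?_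
      · intro s b hb
        rw [sigmaEquiv_apply_of_mem hu (mode_mem_chargeSpace ha hb n),
          sigmaEquiv_apply_of_mem hu ha, sigmaEquiv_apply_of_mem hu hb]
        simp only [mode, map_smul, LinearMap.smul_apply, Pi.smul_apply, smul_smul,
          ← Complex.exp_add]
        congr 2
        push_cast
        ring
      · simp
      · intro x y hx hy
        simp only [map_add, hx, hy]
    · simp [mode]
    · intro x y hx hy
      simp only [mode, map_add, LinearMap.add_apply, Pi.add_apply] at *
      rw [hx, hy]

/-- The internal automorphism `σ(u) = exp(-2πi u_(0))` of `V`. -/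
def sigma {u : V} (hu : A.IsRationalSemisimplePrimary u) : A.aut :=
  ⟨sigmaEquiv hu, sigmaEquiv_mem_aut hu⟩

variable (A)

/-- The formal power series `-∑_{n ≥ 1} (u_(n)/n) (-z)^{-n}` in the variable `z^{-1}`, with
coefficients in `End V`. -/
def deltaExponent (u : V) : PowerSeries (Module.End ℂ V) :=
  PowerSeries.mk fun n : ℕ => if n = 0 then 0 else (-((-1 : ℂ) ^ n / n)) • A.mode u n

/-- The coefficient of `z^{-s}` in `exp(-∑_{n ≥ 1} (u_(n)/n) (-z)^{-n})`, i.e.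
`p_s(u_(1), u_(2), …)` (the exponent has no constant term, so that only the powers `X ^ k` with
`k ≤ s` contribute). -/
def schur (u : V) (s : ℕ) : Module.End ℂ V :=
  ∑ k ∈ Finset.range (s + 1), ((k ! : ℂ)⁻¹) • PowerSeries.coeff s (A.deltaExponent u ^ k)

variable {A}

/-- The coefficient of `z^q` in `Δ(u,z)a`, where
`Δ(u,z) = z^{u_(0)} exp(-∑_{n ≥ 1} (u_(n)/n) (-z)^{-n})` and `z^{u_(0)}` is `z^r` on the
`r`-eigenspace of `u_(0)`. -/
def deltaCoeff {u : V} (hu : A.IsRationalSemisimplePrimary u) (q : ℚ) (a : V) : V :=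
  ∑ᶠ s : ℕ, chargeProj hu (q + s) (A.schur u s a)

variable (A)

/-- A weak `g`-twisted `A`-module structure on `W`. The operator `Y a n` is the mode `a_(n)`,
`n ∈ ℚ`, i.e. `Y_W(a,z) = ∑ a_(n) z^{-n-1}`. Eigenvalues of `g` are written `exp(2πi α)` with
`α` rational; for `g` of finite order the eigenvectors span, so that by `mode_support` only
exponents in `(1/|g|)ℤ` occur. -/
structure WeakTwistedModule (g : A.aut) (W : Type w) [AddCommGroup W] [Module ℂ W] where
  /-- The vertex operators of the module. -/
  Y : V →ₗ[ℂ] ℚ → Module.End ℂ W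
  mode_support : ∀ (α : ℚ) (a : V),
    (g : V ≃ₗ[ℂ] V) a = Complex.exp (2 * Real.pi * Complex.I * (α : ℂ)) • a →
    ∀ n : ℚ, (¬ ∃ k : ℤ, n = k + α) → Y a n = 0
  truncation : ∀ (a : V) (w : W), ∃ N : ℚ, ∀ n : ℚ, N ≤ n → Y a n w = 0
  vacuum_mode : ∀ n : ℚ, Y A.vacuum n = if n = -1 then 1 else 0
  /-- The twisted Jacobi identity for `g a = exp(2πi α) a`: the coefficient of
  `z₀^{-l-1} z₁^{-m-1} z₂^{-n-1}`, where `m ∈ α + ℤ` (for other `m` both sides vanish).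
  On the right, `z₂⁻¹ δ((z₁-z₀)/z₂) ((z₁-z₀)/z₂)^{-α} = z₁⁻¹ δ((z₂+z₀)/z₁) ((z₂+z₀)/z₁)^α`, whose
  coefficient of `z₁^{-m-1}` is `(z₂+z₀)^m = ∑ (m choose i) z₂^{m-i} z₀^i`. -/
  jacobi : ∀ (α : ℚ) (a b : V),
    (g : V ≃ₗ[ℂ] V) a = Complex.exp (2 * Real.pi * Complex.I * (α : ℂ)) • a →
    ∀ (l : ℤ) (m n : ℚ), (∃ k : ℤ, m = k + α) → ∀ w : W,
      ∑ᶠ i : ℕ, ((-1 : ℂ) ^ i * (Ring.choose l i : ℤ)) •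
          (Y a (m + l - i) (Y b (n + i) w) - ((-1 : ℂ) ^ l) • Y b (n + l - i) (Y a (m + i) w))
        = ∑ᶠ i : ℕ, ((Ring.choose m i : ℚ) : ℂ) • Y (A.mode a (l + i) b) (m + n - i) w

/-- An irreducible `g`-twisted `A`-module: a nonzero weak `g`-twisted module without proper
nonzero submodules. -/
structure IrreducibleTwistedModule (g : A.aut) where
  /-- The underlying vector space. -/
  carrier : Type w
  [addCommGroup : AddCommGroup carrier]
  [module : Module ℂ carrier]
  /-- The module structure. -/
  str : A.WeakTwistedModule g carrier
  nontrivial : Nontrivial carrier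
  irreducible : ∀ S : Submodule ℂ carrier,
    (∀ (a : V) (n : ℚ), ∀ x ∈ S, str.Y a n x ∈ S) → S = ⊥ ∨ S = ⊤

attribute [instance] IrreducibleTwistedModule.addCommGroup IrreducibleTwistedModule.module

variable {A}

namespace IrreducibleTwistedModule

/-- Two modules are isomorphic if there is a linear isomorphism commuting with all modes. -/
def Iso {g : A.aut} (M N : IrreducibleTwistedModule.{v, w} A g) : Prop :=
  ∃ f : M.carrier ≃ₗ[ℂ] N.carrier, ∀ (a : V) (n : ℚ) (x : M.carrier),
    f (M.str.Y a n x) = N.str.Y a n (f x)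

/-- `M` is `h`-stable: there is a linear isomorphism `φ` of `M` with
`φ Y(a,z) = Y(ha,z) φ` for all `a ∈ V`. -/
def IsStable {g : A.aut} (h : A.aut) (M : IrreducibleTwistedModule.{v, w} A g) : Prop :=
  ∃ f : M.carrier ≃ₗ[ℂ] M.carrier, ∀ (a : V) (n : ℚ) (x : M.carrier),
    f (M.str.Y a n x) = M.str.Y ((h : V ≃ₗ[ℂ] V) a) n (f x)

/-- `N` is the module `(M, Y_M(Δ(u,z)·,z))`, up to a linear identification `f` of the underlying
spaces: `Y_N(a,z) f = f Y_M(Δ(u,z)a,z)` for all `a ∈ V`. -/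
def IsDeltaTransform {u : V} (hu : A.IsRationalSemisimplePrimary u) {g g' : A.aut}
    (M : IrreducibleTwistedModule.{v, w} A g) (N : IrreducibleTwistedModule.{v, w} A g') : Prop :=
  ∃ f : M.carrier ≃ₗ[ℂ] N.carrier, ∀ (a : V) (n : ℚ) (x : M.carrier),
    N.str.Y a n (f x) = f (∑ᶠ q : ℚ, M.str.Y (deltaCoeff hu q a) (n + q) x)

theorem Iso.isStable {g h : A.aut} {M N : IrreducibleTwistedModule.{v, w} A g} (e : Iso M N)
    (hM : M.IsStable h) : N.IsStable h := by
  obtain ⟨e, he⟩ := e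
  obtain ⟨f, hf⟩ := hM
  refine ⟨e.symm ≪≫ₗ f ≪≫ₗ e, fun a n x => ?_⟩
  have : e.symm (N.str.Y a n x) = M.str.Y a n (e.symm x) := by
    rw [LinearEquiv.symm_apply_eq, he, LinearEquiv.apply_symm_apply]
  simp [this, hf, he]

theorem Iso.symm {g : A.aut} {M N : IrreducibleTwistedModule.{v, w} A g} (e : Iso M N) :
    Iso N M := by
  obtain ⟨e, he⟩ := e
  refine ⟨e.symm, fun a n x => ?_⟩
  rw [LinearEquiv.symm_apply_eq, he, LinearEquiv.apply_symm_apply]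

/-- Isomorphism of irreducible `g`-twisted modules as an equivalence relation. -/
instance setoid (g : A.aut) : Setoid (IrreducibleTwistedModule.{v, w} A g) where
  r := Iso
  iseqv :=
    { refl := fun _ => ⟨LinearEquiv.refl ℂ _, fun _ _ _ => rfl⟩
      symm := Iso.symm
      trans := by
        rintro M N P ⟨e, he⟩ ⟨f, hf⟩
        exact ⟨e ≪≫ₗ f, fun a n x => by simp [he, hf]⟩ }

end IrreducibleTwistedModule

variable (A)

/-- The set of irreducible `g`-twisted modules, up to isomorphism. -/
def IrrTwisted (g : A.aut) : Type _ := Quotient (IrreducibleTwistedModule.setoid.{v, w} (A := A) g)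

variable {A}

/-- The isomorphism class of an irreducible `g`-twisted module. -/
def IrreducibleTwistedModule.isoClass {g : A.aut} (M : IrreducibleTwistedModule.{v, w} A g) :
    IrrTwisted.{v, w} A g := Quotient.mk _ M

/-- The class of an irreducible `g`-twisted module is `h`-stable if the module is. -/
def IrrTwisted.IsStable {g : A.aut} (h : A.aut) (x : IrrTwisted.{v, w} A g) : Prop :=
  Quotient.liftOn x (fun M => M.IsStable h) fun _ _ e =>
    propext ⟨fun hM => IrreducibleTwistedModule.Iso.isStable e hM,
      fun hN => IrreducibleTwistedModule.Iso.isStable (IrreducibleTwistedModule.Iso.symm e) hN⟩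

end VertexOperatorAlgebra

end

/-! Everything rests on the conjugation formula `Δ(u,z₂) Y(a,z₀) = Y(Δ(u,z₂+z₀)a,z₀) Δ(u,z₂)`, which
is Li's argument. Since `u_(m)u` vanishes for `m ≥ 0` except for the central value at `m = 1`, the
operators `u_(n)`, `n ≥ 0`, commute. So the coefficients `schur u s` of the exponential in `Δ`
satisfy `s p_s = ∑ (-1)^(n+1) u_(n) p_(s-n)`, and every property of them is proved by induction
along this recursion: they lower the weight by `s` (so `Δ(u,z)a` is a finite sum), preserve the
charge (the eigenvalue of `u_(0)`), commute with automorphisms fixing `u`, and satisfy the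
conjugation formula (`schur_mode`).

If `a` has charge `r`, then `Δ(u,z)a = ∑ z^(r-s) p_s a`. Thus a Jacobi coefficient for
`Y_W(Δ(u,z)·,z)` is a sum of Jacobi coefficients for `Y_W` with shifted indices, the right-hand
sides being matched by the conjugation formula and Vandermonde's identity
(`twistedJacobi_deltaY_of_mem`). The shift of exponents by `r` compensates for the factor `exp(-2πi
r)` by which `gσ(u)` differs from `g` on charge `r`, so the result is `gσ(u)`-twisted.

As `Δ(u,z)Δ(-u,z) = 1`, the construction for `-u` is a two-sided inverse (`deltaY_deltaY`). This
gives bijectivity and, because each family of modes is expressed through the other, equality of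
submodules. An automorphism fixing `u` commutes with `Δ(u,z)`, so isomorphisms and stabilizing maps
are carried over unchanged (`deltaY_intertwine`). -/

noncomputable section

open scoped VertexOperator Nat

open Finset

/-! ### Reindexing of sums over triples with fixed total. -/

section Antidiagonal

variable {M : Type*} [AddCommMonoid M]

theorem sum_antidiagonal_assoc (f : ℕ → ℕ → ℕ → M) (s : ℕ) :
    ∑ x ∈ antidiagonal s, ∑ y ∈ antidiagonal x.2, f x.1 y.1 y.2
      = ∑ x ∈ antidiagonal s, ∑ y ∈ antidiagonal x.1, f y.1 y.2 x.2 := by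
  rw [Finset.sum_sigma', Finset.sum_sigma']
  refine Finset.sum_nbij' (fun p => ⟨(p.1.1 + p.2.1, p.2.2), (p.1.1, p.2.1)⟩)
    (fun p => ⟨(p.2.1, p.2.2 + p.1.2), (p.2.2, p.1.2)⟩) ?_ ?_ ?_ ?_ ?_
  all_goals
    rintro ⟨⟨a, b⟩, ⟨c, d⟩⟩
    simp only [mem_sigma, HasAntidiagonal.mem_antidiagonal, Sigma.mk.injEq, Prod.mk.injEq, heq_eq_eq, and_imp]
    intros
    try simp
    try omega

theorem sum_antidiagonal_left_comm (f : ℕ → ℕ → ℕ → M) (s : ℕ) :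
    ∑ x ∈ antidiagonal s, ∑ y ∈ antidiagonal x.2, f x.1 y.1 y.2
      = ∑ x ∈ antidiagonal s, ∑ y ∈ antidiagonal x.2, f y.1 x.1 y.2 := by
  rw [sum_antidiagonal_assoc, sum_antidiagonal_assoc fun a b c => f b a c]
  exact Finset.sum_congr rfl fun x _ =>
    (Finset.Nat.sum_antidiagonal_swap (f := fun y => f y.1 y.2 x.2)).symm

end Antidiagonal

/-! ### Binomial identities with rational upper argument. -/

section Choose

theorem choose_add_eq_sum (x y : ℚ) (n : ℕ) :
    Ring.choose (x + y) n = ∑ p ∈ antidiagonal n, Ring.choose x p.1 * Ring.choose y p.2 :=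
  Ring.add_choose_eq n (Commute.all x y)

theorem choose_neg_nat_succ (p m : ℕ) :
    Ring.choose (-(p : ℚ) - 1) m = (-1) ^ m * ((p + m).choose p : ℚ) := by
  have h : (-(p : ℚ) - 1) = -((p : ℚ) + 1) := by ring
  rw [h, Ring.choose_neg]
  have h2 : ((p : ℚ) + 1 + m - 1) = ((p + m : ℕ) : ℚ) := by push_cast; ring
  rw [h2, Ring.choose_natCast, Nat.choose_symm_add, Int.negOnePow_def]
  simp [Units.smul_def]

/-- The coefficient of `z^n` in `(1+z)^(-p-1) (1+z)^(x+p) = (1+z)^(x-1)`. -/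
theorem sum_neg_choose_mul_choose (x : ℚ) (p n : ℕ) :
    ∑ q ∈ antidiagonal n, ((-1) ^ q.1 * ((p + q.1).choose p : ℚ)) * Ring.choose (x + p) q.2
      = Ring.choose (x - 1) n := by
  have h : x - 1 = (-(p : ℚ) - 1) + (x + p) := by ring
  rw [h, choose_add_eq_sum]
  simp only [choose_neg_nat_succ]

theorem succ_mul_choose_succ (x : ℚ) (n : ℕ) :
    (n + 1 : ℚ) * Ring.choose x (n + 1) = x * Ring.choose (x - 1) n := by
  have h := Ring.choose_smul_choose x (n := n + 1) (k := 1) (by omega)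
  simpa using h

theorem choose_succ_sub_one (x : ℚ) (n : ℕ) :
    Ring.choose x (n + 1) = Ring.choose (x - 1) n + Ring.choose (x - 1) (n + 1) := by
  have h := Ring.choose_succ_succ (x - 1) n
  rwa [sub_add_cancel] at h

/-- The coefficients `(-1)^{n+1}`, `n ≥ 1`, of `z / (1 + z)`. -/
def altCoeff (n : ℕ) : ℚ := if n = 0 then 0 else (-1) ^ (n + 1)

theorem sum_altCoeff_mul_choose (x : ℚ) (n : ℕ) :
    ∑ q ∈ antidiagonal (n + 1), altCoeff q.1 * Ring.choose x q.2 = Ring.choose (x - 1) n := by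
  rw [Finset.Nat.sum_antidiagonal_succ]
  have h := sum_neg_choose_mul_choose x 0 n
  simp only [Nat.choose_zero_right, CharP.cast_eq_zero, add_zero] at h
  rw [← h]
  simp [altCoeff, pow_succ]

/-- The numerical identity that closes the induction for `schur_mode`: the three terms on the left
come from the charge of `a`, from `u` acting on `a`, and from `u` acting on `b`. It reduces to
Pascal's rule and absorption. -/
theorem weighted_choose_identity (r : ℚ) (j i t : ℕ) :
    r * (∑ q ∈ antidiagonal i, altCoeff q.1 * Ring.choose (r - j) q.2)
      + j * Ring.choose (r - j - 1) i + t * Ring.choose (r - j) i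
      = (j + i + t) * Ring.choose (r - j) i := by
  cases i with
  | zero => simp [altCoeff]
  | succ i =>
    rw [sum_altCoeff_mul_choose]
    have h1 := succ_mul_choose_succ (r - j) i
    have h2 := choose_succ_sub_one (r - j) i
    push_cast
    linear_combination (j : ℚ) * h2 * (-1) - h1

end Choose

/-! ### Exponentials of power series with commuting coefficients. -/

section ExpCoeff

theorem commute_of_coeff {S : Type*} [Ring S] {E F : PowerSeries S}
    (h : ∀ m n, Commute (PowerSeries.coeff m E) (PowerSeries.coeff n F)) : Commute E F := by
  ext n
  rw [PowerSeries.coeff_mul, PowerSeries.coeff_mul, ← Finset.Nat.sum_antidiagonal_swap]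
  exact Finset.sum_congr rfl fun x _ => h _ _

theorem coeff_pow_eq_zero {S : Type*} [Ring S] {E : PowerSeries S} (h0 : PowerSeries.coeff 0 E = 0) {s k : ℕ}
    (hk : s < k) : PowerSeries.coeff s (E ^ k) = 0 := by
  induction k generalizing s with
  | zero => omega
  | succ k ih =>
    rw [pow_succ, PowerSeries.coeff_mul]
    refine Finset.sum_eq_zero fun x hx => ?_
    rw [HasAntidiagonal.mem_antidiagonal] at hx
    by_cases hx2 : x.2 = 0
    · rw [hx2, h0, mul_zero]
    · rw [ih (by omega), zero_mul]

variable {R : Type*} [Ring R] [Algebra ℂ R]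

/-- The coefficient of `X ^ s` in `exp E`, for a power series `E` without constant term. -/
def expCoeff (E : PowerSeries R) (s : ℕ) : R :=
  ∑ k ∈ range (s + 1), ((k ! : ℂ)⁻¹) • PowerSeries.coeff s (E ^ k)

/-- The Euler derivation `X d/dX` on power series. -/
def eulerDeriv (E : PowerSeries R) : PowerSeries R :=
  PowerSeries.mk fun n => (n : ℂ) • PowerSeries.coeff n E

theorem eulerDeriv_mul (E F : PowerSeries R) :
    eulerDeriv (E * F) = eulerDeriv E * F + E * eulerDeriv F := by
  ext n
  simp only [eulerDeriv, PowerSeries.coeff_mk, PowerSeries.coeff_mul, map_add, Finset.smul_sum,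
    ← Finset.sum_add_distrib]
  refine Finset.sum_congr rfl fun x hx => ?_
  rw [← HasAntidiagonal.mem_antidiagonal.1 hx]
  push_cast
  simp [add_smul]

theorem eulerDeriv_pow_succ {E : PowerSeries R} (h : Commute E (eulerDeriv E)) (k : ℕ) :
    eulerDeriv (E ^ (k + 1)) = ((k : ℂ) + 1) • (eulerDeriv E * E ^ k) := by
  induction k with
  | zero => simp
  | succ k ih =>
    rw [pow_succ, eulerDeriv_mul, ih, (h.pow_left (k + 1)).eq, smul_mul_assoc, mul_assoc,
      ← pow_succ]
    push_cast
    module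

theorem expCoeff_eq_sum_range {E : PowerSeries R} (h0 : PowerSeries.coeff 0 E = 0) {s N : ℕ}
    (hN : s < N) :
    expCoeff E s = ∑ k ∈ range N, ((k ! : ℂ)⁻¹) • PowerSeries.coeff s (E ^ k) := by
  refine Finset.sum_subset (fun k hk => ?_) fun k _ hk => ?_
  · simp only [mem_range] at *; omega
  · rw [coeff_pow_eq_zero h0 (by simpa using hk), smul_zero]

/-- With `D = X d/dX`, this is `D exp(E) = (DE) exp(E)` read off in degree `s`; commutativity of the
coefficients makes `D(E^(k+1)) = (k+1)(DE)E^k` available. -/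
theorem smul_expCoeff {E : PowerSeries R} (h0 : PowerSeries.coeff 0 E = 0)
    (hc : ∀ m n, Commute (PowerSeries.coeff m E) (PowerSeries.coeff n E)) (s : ℕ) :
    (s : ℂ) • expCoeff E s
      = ∑ x ∈ antidiagonal s, ((x.1 : ℂ) • PowerSeries.coeff x.1 E) * expCoeff E x.2 := by
  have hE : Commute E (eulerDeriv E) := commute_of_coeff fun m n => by
    simpa [eulerDeriv] using (hc m n).smul_right (n : ℂ)
  have h1 : ∀ k, (s : ℂ) • PowerSeries.coeff s (E ^ k) = PowerSeries.coeff s (eulerDeriv (E ^ k)) :=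
    fun k => by simp [eulerDeriv]
  -- One superfluous zero term is included, so that after removing `k = 0` the range is `s + 1`, as
  -- on the right.
  rw [expCoeff_eq_sum_range h0 (N := s + 2) (by omega), Finset.smul_sum, Finset.sum_range_succ']
  simp only [smul_comm (s : ℂ), h1, eulerDeriv_pow_succ hE]
  have h2 : eulerDeriv (E ^ 0) = 0 := by
    ext n
    by_cases hn : n = 0 <;> simp [eulerDeriv, PowerSeries.coeff_one, hn]
  rw [h2]
  simp only [map_zero, smul_zero, add_zero]
  have h3 : ∀ x ∈ antidiagonal s, ((x.1 : ℂ) • PowerSeries.coeff x.1 E) * expCoeff E x.2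
      = ∑ k ∈ range (s + 1), ((k ! : ℂ)⁻¹) •
        (PowerSeries.coeff x.1 (eulerDeriv E) * PowerSeries.coeff x.2 (E ^ k)) := by
    intro x hx
    rw [HasAntidiagonal.mem_antidiagonal] at hx
    rw [expCoeff_eq_sum_range h0 (N := s + 1) (by omega), Finset.mul_sum]
    simp [eulerDeriv]
  rw [Finset.sum_congr rfl h3, Finset.sum_comm]
  refine Finset.sum_congr rfl fun k _ => ?_
  rw [← Finset.smul_sum, ← PowerSeries.coeff_mul]
  have h4 : ((k : ℂ) + 1) ≠ 0 := by exact_mod_cast Nat.succ_ne_zero k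
  have h5 : (k ! : ℂ) ≠ 0 := by exact_mod_cast Nat.factorial_ne_zero k
  rw [PowerSeries.coeff_smul, smul_smul, Nat.factorial_succ]
  congr 1
  push_cast
  field_simp

theorem expCoeff_zero (E : PowerSeries R) : expCoeff E 0 = 1 := by
  simp [expCoeff]

end ExpCoeff

/-- Passes between summation by total degree and summation over a box containing the support; it
turns the convolution formulas into independent finite sums. -/
theorem sum_range_sum_antidiagonal {M : Type*} [AddCommMonoid M] (f : ℕ → ℕ → M) {B C K : ℕ}
    (hf : ∀ j t, B ≤ j ∨ C ≤ t → f j t = 0) (hK : B + C ≤ K) :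
    ∑ e ∈ range K, ∑ x ∈ antidiagonal e, f x.1 x.2 = ∑ j ∈ range B, ∑ t ∈ range C, f j t := by
  rw [Finset.sum_sigma', ← Finset.sum_product']
  refine Finset.sum_bij_ne_zero (fun p _ _ => p.2) ?_ ?_ ?_ ?_
  · rintro ⟨e, j, t⟩ _ h
    by_contra hc
    refine h (hf j t ?_)
    simp only [mem_product, mem_range, not_and_or, not_lt] at hc
    exact hc
  · rintro ⟨e, j, t⟩ h _ ⟨e', j', t'⟩ h' _ heq
    simp only [mem_sigma, HasAntidiagonal.mem_antidiagonal] at h h'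
    simp only [Prod.mk.injEq] at heq
    obtain ⟨rfl, rfl⟩ := heq
    obtain ⟨_, rfl⟩ := h
    obtain ⟨_, rfl⟩ := h'
    rfl
  · rintro ⟨j, t⟩ h hne
    simp only [mem_product, mem_range] at h
    exact ⟨⟨j + t, (j, t)⟩, by simp; omega, hne, rfl⟩
  · rintro ⟨e, j, t⟩ _ _
    rfl

namespace VertexOperatorAlgebra

variable {V : Type v} [AddCommGroup V] [Module ℂ V] {A : VertexOperatorAlgebra V} {u : V}

/-! ### Modes on the vertex operator algebra. -/

section Modes

theorem mode_add (a b : V) (n : ℤ) : A.mode (a + b) n = A.mode a n + A.mode b n := by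
  simp [mode]

theorem mode_smul (c : ℂ) (a : V) (n : ℤ) : A.mode (c • a) n = c • A.mode a n := by
  simp [mode]

theorem mode_zero (n : ℤ) : A.mode (0 : V) n = 0 := by
  simp [mode]

theorem mode_neg (a : V) (n : ℤ) : A.mode (-a) n = -A.mode a n := by
  simp [mode]

theorem mode_sum {ι : Type*} (s : Finset ι) (f : ι → V) (n : ℤ) :
    A.mode (∑ i ∈ s, f i) n = ∑ i ∈ s, A.mode (f i) n := by
  simp [mode]

theorem mode_vacuum (n : ℤ) (b : V) : A.mode A.vacuum n b = if n = -1 then b else 0 :=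
  A.vacuum_mode n b

theorem exists_mode_eq_zero (a b : V) : ∃ N : ℤ, ∀ n, N ≤ n → A.mode a n b = 0 := by
  refine ⟨-((HahnModule.of ℂ).symm (A.Y a b)).order, fun n hn => ?_⟩
  exact VertexOperator.ncoeff_eq_zero_of_lt_order _ _ _ (by omega)

/-- The commutator formula for `a_(n)` with `n ≥ 0`. -/
theorem mode_nat_mode (a b c : V) (m : ℕ) (n : ℤ) :
    A.mode a m (A.mode b n c) = A.mode b n (A.mode a m c)
      + ∑ x ∈ antidiagonal m, (m.choose x.1 : ℂ) • A.mode (A.mode a x.1 b) (n + x.2) c := by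
  rw [← sub_eq_iff_eq_add', mode_commutator, Finset.Nat.sum_antidiagonal_eq_sum_range_succ_mk,
    finsum_eq_sum_of_support_subset (s := range (m + 1))]
  · refine Finset.sum_congr rfl fun i hi => ?_
    rw [mem_range] at hi
    have hi' : (m : ℤ) + n - i = n + ((m - i : ℕ) : ℤ) := by omega
    rw [Ring.choose_natCast, hi', Int.cast_natCast]
  · intro i hi
    by_contra hc
    apply hi
    have : m < i := by simpa using hc
    simp [Ring.choose_natCast, Nat.choose_eq_zero_of_lt this]

end Modes

/-! ### The recursion for the coefficients of the exponential in Δ, and its consequences. -/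

section Primary

/-- Only `i = 1` survives in the commutator formula, giving `mγ` times the vacuum mode of index `m +
n - 1`; for `m, n ≥ 0` this is nonzero only at `m = n = 0`, where the factor `m` kills it. -/
theorem IsSemisimplePrimary.commute_mode (hu : A.IsSemisimplePrimary u) (m n : ℕ) :
    Commute (A.mode u m) (A.mode u n) := by
  obtain ⟨γ, hγ⟩ := hu.self_mode
  ext c
  rw [Module.End.mul_apply, Module.End.mul_apply, ← sub_eq_zero, mode_commutator]
  refine finsum_eq_zero_of_forall_eq_zero fun i => ?_
  rw [hγ i (by omega)]
  split_ifs with h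
  · have hi : i = 1 := by exact_mod_cast h
    subst hi
    rw [mode_smul, LinearMap.smul_apply, mode_vacuum]
    split_ifs with h2
    · have : m = 0 := by omega
      subst this
      simp
    · simp
  · simp [mode_zero]

theorem IsSemisimplePrimary.L_zero_mode (hu : A.IsSemisimplePrimary u) (n : ℤ) (c : V) :
    A.L 0 (A.mode u n c) = A.mode u n (A.L 0 c) - (n : ℂ) • A.mode u n c := by
  have h := mode_commutator (A := A) A.conformal u c 1 n
  rw [finsum_eq_sum_of_support_subset (s := {0, 1})] at h
  · rw [Finset.sum_pair (by norm_num)] at h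
    have h0 := hu.L_zero
    have ht := A.translation u c (n + 1)
    simp only [L, zero_add] at h0 ⊢
    rw [sub_eq_iff_eq_add] at h
    rw [h]
    change A.mode (A.mode A.conformal 0 u) (n + 1) c
      = (-((n + 1 : ℤ) : ℂ)) • ((A.Y u)[[n + 1 - 1]]) c at ht
    have ht2 : (-((n + 1 : ℤ) : ℂ)) • ((A.Y u)[[n + 1 - 1]]) c
        = (-((n : ℂ) + 1)) • A.mode u n c := by
      rw [add_sub_cancel_right]; push_cast; rfl
    rw [ht2] at ht
    simp only [Nat.cast_zero, Nat.cast_one, sub_zero, h0]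
    rw [show (1 : ℤ) + n = n + 1 by ring, ht, add_sub_cancel_right]
    simp
    module
  · intro i hi
    by_contra hc
    apply hi
    have : 1 < i := by
      simp only [coe_insert, coe_singleton, Set.mem_insert_iff, Set.mem_singleton_iff,
        not_or] at hc
      omega
    have h1 : Ring.choose (1 : ℤ) i = 0 := by
      have := Ring.choose_natCast (R := ℤ) 1 i
      rw [Nat.choose_eq_zero_of_lt ‹1 < i›] at this
      simpa using this
    simp [h1]

/-- The operators `(-1)^{n+1} u_(n)` for `n ≥ 1`, with value zero at `n = 0`: the coefficients of
the logarithmic derivative of the exponential in `Δ(u,z)`. -/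
def logCoeff (A : VertexOperatorAlgebra V) (u : V) (n : ℕ) : Module.End ℂ V :=
  (altCoeff n : ℂ) • A.mode u n

theorem logCoeff_zero : A.logCoeff u 0 = 0 := by
  simp [logCoeff, altCoeff]

theorem logCoeff_neg (n : ℕ) : A.logCoeff (-u) n = -A.logCoeff u n := by
  simp [logCoeff, mode_neg]

theorem schur_eq_expCoeff (s : ℕ) : A.schur u s = expCoeff (A.deltaExponent u) s := rfl

theorem schur_zero : A.schur u 0 = 1 := by
  rw [schur_eq_expCoeff, expCoeff_zero]

theorem coeff_deltaExponent (n : ℕ) :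
    (n : ℂ) • PowerSeries.coeff n (A.deltaExponent u) = A.logCoeff u n := by
  rw [deltaExponent, PowerSeries.coeff_mk, logCoeff, altCoeff]
  by_cases hn : n = 0
  · simp [hn]
  · rw [if_neg hn, if_neg hn, smul_smul]
    congr 1
    have : (n : ℂ) ≠ 0 := by exact_mod_cast hn
    push_cast
    field_simp
    ring

theorem IsSemisimplePrimary.smul_schur (hu : A.IsSemisimplePrimary u) (s : ℕ) :
    (s : ℂ) • A.schur u s = ∑ x ∈ antidiagonal s, A.logCoeff u x.1 * A.schur u x.2 := by
  rw [schur_eq_expCoeff, smul_expCoeff]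
  · simp only [coeff_deltaExponent]
    rfl
  · simp [deltaExponent]
  · intro m n
    simp only [deltaExponent, PowerSeries.coeff_mk]
    split_ifs
    · exact Commute.zero_left _
    · exact Commute.zero_left _
    · exact Commute.zero_right _
    · exact ((hu.commute_mode m n).smul_left _).smul_right _

theorem IsSemisimplePrimary.smul_schur_apply (hu : A.IsSemisimplePrimary u) (s : ℕ) (a : V) :
    (s : ℂ) • A.schur u s a
      = ∑ x ∈ antidiagonal s, A.logCoeff u x.1 (A.schur u x.2 a) := by
  have h := congrArg (fun f : Module.End ℂ V => f a) (hu.smul_schur s)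
  simpa [LinearMap.sum_apply] using h

/-- Induction principle for the operators `schur u s`, from the recursion that they satisfy. -/
theorem IsSemisimplePrimary.schur_eq_of_recursion (hu : A.IsSemisimplePrimary u) {M : Type*}
    [AddCommGroup M] [Module ℂ M] (f : V →ₗ[ℂ] M) (a : V) (F : ℕ → M) (h0 : f a = F 0)
    (hF : ∀ s, 0 < s → (∀ t < s, f (A.schur u t a) = F t) →
      ∑ x ∈ antidiagonal s, f (A.logCoeff u x.1 (A.schur u x.2 a)) = (s : ℂ) • F s) (s : ℕ) :
    f (A.schur u s a) = F s := by
  induction s using Nat.strong_induction_on with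
  | _ s ih =>
    rcases Nat.eq_zero_or_pos s with rfl | hs
    · simpa [schur_zero] using h0
    · have hs' : (s : ℂ) ≠ 0 := by exact_mod_cast hs.ne'
      refine smul_right_injective M hs' ?_
      change (s : ℂ) • f _ = (s : ℂ) • _
      rw [← hF s hs ih, ← map_smul, hu.smul_schur_apply, map_sum]

theorem IsSemisimplePrimary.schur_vacuum (hu : A.IsSemisimplePrimary u) {s : ℕ} (hs : 0 < s) :
    A.schur u s A.vacuum = 0 := by
  have h := hu.schur_eq_of_recursion (M := V) LinearMap.id A.vacuum
    (fun s => if s = 0 then A.vacuum else 0) (by simp) ?_ s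
  · simpa [hs.ne'] using h
  · intro s hs ih
    simp only [hs.ne', if_false, smul_zero]
    refine Finset.sum_eq_zero fun x hx => ?_
    rw [HasAntidiagonal.mem_antidiagonal] at hx
    by_cases h1 : x.1 = 0
    · simp [h1, logCoeff_zero]
    · have := ih x.2 (by omega)
      rw [LinearMap.id_apply] at this ⊢
      rw [this]
      split_ifs
      · have hv : A.mode u x.1 A.vacuum = 0 := A.creation_regular u x.1 (by omega)
        simp [logCoeff, hv]
      · simp

theorem IsSemisimplePrimary.L_zero_schur (hu : A.IsSemisimplePrimary u) {k : ℂ} {a : V}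
    (ha : A.L 0 a = k • a) (s : ℕ) : A.L 0 (A.schur u s a) = (k - s) • A.schur u s a := by
  rw [← sub_eq_zero]
  induction s using Nat.strong_induction_on with
  | _ s ih =>
    rcases Nat.eq_zero_or_pos s with rfl | hs
    · simp [schur_zero, ha]
    · have hs' : (s : ℂ) ≠ 0 := by exact_mod_cast hs.ne'
      refine smul_right_injective V hs' ?_
      change (s : ℂ) • _ = (s : ℂ) • (0 : V)
      rw [smul_zero, smul_sub, ← map_smul, smul_comm, hu.smul_schur_apply, map_sum,
        Finset.smul_sum, ← Finset.sum_sub_distrib]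
      refine Finset.sum_eq_zero fun x hx => ?_
      rw [HasAntidiagonal.mem_antidiagonal] at hx
      by_cases h1 : x.1 = 0
      · simp [h1, logCoeff_zero]
      · have := sub_eq_zero.1 (ih x.2 (by omega))
        rw [logCoeff, LinearMap.smul_apply, map_smul, hu.L_zero_mode, this, map_smul, ← hx]
        push_cast
        module

/-- `schur u s` lowers the weight by `s` and the weights are bounded below. -/
theorem IsSemisimplePrimary.exists_schur_eq_zero (hu : A.IsSemisimplePrimary u) (a : V) :
    ∃ N : ℕ, ∀ s, N ≤ s → A.schur u s a = 0 := by
  have htop := A.weight_decomposition.submodule_iSup_eq_top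
  have ha : a ∈ ⨆ n : ℤ, Module.End.eigenspace ((A.Y A.conformal)[[1]]) (n : ℂ) :=
    htop ▸ Submodule.mem_top
  obtain ⟨N, hN⟩ := A.weight_bounded
  induction ha using Submodule.iSup_induction' with
  | mem n a ha =>
    refine ⟨(n - N + 1).toNat, fun s hs => ?_⟩
    rw [Module.End.mem_eigenspace_iff] at ha
    have h := hu.L_zero_schur (k := (n : ℂ)) (a := a) ha s
    have hmem : A.schur u s a ∈
        Module.End.eigenspace ((A.Y A.conformal)[[1]]) ((n - s : ℤ) : ℂ) := by
      rw [Module.End.mem_eigenspace_iff]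
      push_cast
      exact h
    rw [hN (n - s) (by omega)] at hmem
    simpa using hmem
  | zero => exact ⟨0, by simp⟩
  | add a b _ _ ha hb =>
    obtain ⟨N1, h1⟩ := ha
    obtain ⟨N2, h2⟩ := hb
    exact ⟨max N1 N2, fun s hs => by
      rw [map_add, h1 s (le_trans (le_max_left _ _) hs),
        h2 s (le_trans (le_max_right _ _) hs), add_zero]⟩

theorem mem_chargeSpace_zero (hu : A.IsSemisimplePrimary u) : u ∈ A.chargeSpace u 0 := by
  obtain ⟨γ, hγ⟩ := hu.self_mode
  rw [chargeSpace, Module.End.mem_eigenspace_iff, hγ 0 le_rfl]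
  simp

theorem IsSemisimplePrimary.schur_mem_chargeSpace (hu : A.IsSemisimplePrimary u) {r : ℚ} {a : V}
    (ha : a ∈ A.chargeSpace u r) (s : ℕ) : A.schur u s a ∈ A.chargeSpace u r := by
  rw [← Submodule.Quotient.mk_eq_zero]
  -- Membership becomes an equation, to which the recursion applies, after passing to the quotient.
  refine hu.schur_eq_of_recursion (A.chargeSpace u r).mkQ a (fun _ => 0)
    ((Submodule.Quotient.mk_eq_zero _).2 ha) (fun s hs ih => ?_) s
  rw [smul_zero]
  refine Finset.sum_eq_zero fun x hx => ?_
  rw [HasAntidiagonal.mem_antidiagonal] at hx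
  by_cases h1 : x.1 = 0
  · simp [h1, logCoeff_zero]
  · have := (Submodule.Quotient.mk_eq_zero _).1 (ih x.2 (by omega))
    refine (Submodule.Quotient.mk_eq_zero _).2 (Submodule.smul_mem _ _ ?_)
    simpa using mode_mem_chargeSpace (mem_chargeSpace_zero hu) this (x.1 : ℤ)

/-- An automorphism fixing `u` commutes with the coefficients of `Δ(u,z)`. -/
theorem IsSemisimplePrimary.map_schur (hu : A.IsSemisimplePrimary u) (h : A.aut)
    (hh : (h : V ≃ₗ[ℂ] V) u = u) (s : ℕ) (a : V) :
    (h : V ≃ₗ[ℂ] V) (A.schur u s a) = A.schur u s ((h : V ≃ₗ[ℂ] V) a) := by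
  refine hu.schur_eq_of_recursion (h : V ≃ₗ[ℂ] V).toLinearMap a
    (fun s => A.schur u s ((h : V ≃ₗ[ℂ] V) a)) (by simp [schur_zero]) (fun s hs ih => ?_) s
  rw [hu.smul_schur_apply]
  refine Finset.sum_congr rfl fun x hx => ?_
  rw [HasAntidiagonal.mem_antidiagonal] at hx
  by_cases h1 : x.1 = 0
  · simp [h1, logCoeff_zero]
  · rw [← ih x.2 (by omega)]
    simp only [logCoeff, LinearMap.smul_apply, map_smul, LinearEquiv.coe_coe]
    rw [h.2.2.2, hh]

theorem IsSemisimplePrimary.commute_logCoeff_schur (hu : A.IsSemisimplePrimary u) (n s : ℕ)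
    (a : V) : A.logCoeff u n (A.schur u s a) = A.schur u s (A.logCoeff u n a) := by
  refine hu.schur_eq_of_recursion (A.logCoeff u n) a
    (fun s => A.schur u s (A.logCoeff u n a)) (by simp [schur_zero]) (fun s hs ih => ?_) s
  rw [hu.smul_schur_apply]
  refine Finset.sum_congr rfl fun x hx => ?_
  rw [HasAntidiagonal.mem_antidiagonal] at hx
  by_cases h1 : x.1 = 0
  · simp [h1, logCoeff_zero]
  · rw [← ih x.2 (by omega)]
    have hc : Commute (A.logCoeff u n) (A.logCoeff u x.1) :=
      ((hu.commute_mode n x.1).smul_left _).smul_right _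
    exact congrArg (fun f : Module.End ℂ V => f (A.schur u x.2 a)) hc.eq

end Primary

/-! ### The conjugation formula for Δ. -/

section Conjugation

/-- The commutator formula with the signs absorbed into `logCoeff`. Its `i = 0` term involves
`u_(0)a = ra`, which `logCoeff u 0 = 0` cannot record; hence the separate last summand. -/
theorem logCoeff_mode {r : ℚ} {a : V} (ha : a ∈ A.chargeSpace u r) (b : V) (k : ℤ) (n : ℕ) :
    A.logCoeff u n (A.mode a k b) = A.mode a k (A.logCoeff u n b)
      + ∑ x ∈ antidiagonal n, (((-1) ^ x.2 * ((x.1 + x.2).choose x.1 : ℚ) : ℚ) : ℂ) •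
          A.mode (A.logCoeff u x.1 a) (k + x.2) b
      + ((altCoeff n * r : ℚ) : ℂ) • A.mode a (k + n) b := by
  cases n with
  | zero => simp [logCoeff_zero, altCoeff, mode_zero]
  | succ n =>
    have ha' : A.mode u ((0 : ℕ) : ℤ) a = (r : ℂ) • a := Module.End.mem_eigenspace_iff.1 ha
    rw [Finset.Nat.sum_antidiagonal_succ]
    simp only [logCoeff_zero, LinearMap.zero_apply, mode_zero, smul_zero, zero_add]
    rw [logCoeff, LinearMap.smul_apply, mode_nat_mode, Finset.Nat.sum_antidiagonal_succ, ha']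
    simp only [LinearMap.smul_apply, map_smul, smul_add, Nat.choose_zero_right, Nat.cast_one,
      one_smul, mode_smul]
    rw [add_assoc]
    congr 1
    rw [add_comm, smul_smul, Finset.smul_sum]
    congr 1
    · refine Finset.sum_congr rfl fun x hx => ?_
      rw [HasAntidiagonal.mem_antidiagonal] at hx
      simp only [logCoeff, LinearMap.smul_apply, mode_smul, smul_smul]
      congr 1
      have : x.1 + 1 + x.2 = n + 1 := by omega
      rw [this, ← hx]
      simp only [altCoeff, Nat.succ_ne_zero, if_false]
      push_cast
      have h2 : ((-1 : ℂ) ^ x.2) * ((-1) ^ x.2) = 1 := by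
        rw [← mul_pow]; simp
      ring
    · push_cast
      rfl

/-- The conjugation formula `Δ(u,z₂) Y(a,z₀) = Y(Δ(u,z₂+z₀) a,z₀) Δ(u,z₂)`, on coefficients. -/
theorem IsSemisimplePrimary.schur_mode (hu : A.IsSemisimplePrimary u) {r : ℚ} {a : V}
    (ha : a ∈ A.chargeSpace u r) (b : V) (k : ℤ) (s : ℕ) :
    A.schur u s (A.mode a k b) = ∑ x ∈ antidiagonal s, ∑ y ∈ antidiagonal x.2,
      ((Ring.choose (r - x.1) y.1 : ℚ) : ℂ) •
        A.mode (A.schur u x.1 a) (k + y.1) (A.schur u y.2 b) := by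
  -- The right-hand side is shown to obey the recursion of `schur`. The factor `Ring.choose (r - j)
  -- i` is the coefficient of `z₀^i` in `(z₂+z₀)^(r-j)`, which multiplies `schur u j a` in
  -- `Δ(u,z₂+z₀)a`.
  refine hu.schur_eq_of_recursion LinearMap.id (A.mode a k b) (fun s => ∑ x ∈ antidiagonal s,
    ∑ y ∈ antidiagonal x.2, ((Ring.choose (r - x.1) y.1 : ℚ) : ℂ) •
        A.mode (A.schur u x.1 a) (k + y.1) (A.schur u y.2 b)) (by simp [schur_zero])
    (fun s hs ih => ?_) s
  have h1 : ∀ x ∈ antidiagonal s, (LinearMap.id : V →ₗ[ℂ] V) (A.logCoeff u x.1 (A.schur u x.2 (A.mode a k b)))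
      = (∑ y ∈ antidiagonal x.2, ∑ z ∈ antidiagonal y.2,
          ((Ring.choose (r - y.1) z.1 : ℚ) : ℂ) •
            A.mode (A.schur u y.1 a) (k + z.1) (A.logCoeff u x.1 (A.schur u z.2 b)))
        + (∑ q ∈ antidiagonal x.1, ∑ y ∈ antidiagonal x.2, ∑ z ∈ antidiagonal y.2,
          (((-1) ^ q.2 * ((q.1 + q.2).choose q.1 : ℚ) * Ring.choose (r - y.1) z.1 : ℚ) : ℂ) •
            A.mode (A.logCoeff u q.1 (A.schur u y.1 a)) (k + ((q.2 + z.1 : ℕ) : ℤ))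
              (A.schur u z.2 b))
        + (∑ y ∈ antidiagonal x.2, ∑ z ∈ antidiagonal y.2,
          ((r * (altCoeff x.1 * Ring.choose (r - y.1) z.1) : ℚ) : ℂ) •
            A.mode (A.schur u y.1 a) (k + ((x.1 + z.1 : ℕ) : ℤ)) (A.schur u z.2 b)) := by
    intro x hx
    rw [HasAntidiagonal.mem_antidiagonal] at hx
    rw [LinearMap.id_apply]
    rcases Nat.eq_zero_or_pos x.1 with h0 | h0
    · simp [h0, logCoeff_zero, mode_zero, altCoeff]
    · have := ih x.2 (by omega)
      rw [LinearMap.id_apply] at this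
      rw [this, map_sum, Finset.sum_comm, ← Finset.sum_add_distrib, ← Finset.sum_add_distrib]
      refine Finset.sum_congr rfl fun y _ => ?_
      rw [map_sum, Finset.sum_comm, ← Finset.sum_add_distrib, ← Finset.sum_add_distrib]
      refine Finset.sum_congr rfl fun z _ => ?_
      rw [map_smul, logCoeff_mode (hu.schur_mem_chargeSpace ha y.1), smul_add, smul_add,
        Finset.smul_sum]
      congr 1
      · congr 1
        refine Finset.sum_congr rfl fun q _ => ?_
        rw [smul_smul]
        congr 1
        · push_cast; ring
        · congr 2; push_cast; ring
      · rw [smul_smul]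
        congr 1
        · push_cast; ring
        · congr 2; push_cast; ring
  rw [Finset.sum_congr rfl h1, Finset.sum_add_distrib, Finset.sum_add_distrib]
  -- Action on `b`: the recursion for `schur u t b` sums it to a factor `t`.
  have t1 := calc
    ∑ x ∈ antidiagonal s, ∑ y ∈ antidiagonal x.2, ∑ z ∈ antidiagonal y.2,
        ((Ring.choose (r - y.1) z.1 : ℚ) : ℂ) •
          A.mode (A.schur u y.1 a) (k + z.1) (A.logCoeff u x.1 (A.schur u z.2 b))
      = ∑ x ∈ antidiagonal s, ∑ y ∈ antidiagonal x.2, ∑ z ∈ antidiagonal y.2,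
        ((Ring.choose (r - x.1) y.1 : ℚ) : ℂ) •
          A.mode (A.schur u x.1 a) (k + y.1) (A.logCoeff u z.1 (A.schur u z.2 b)) := by
        rw [sum_antidiagonal_left_comm fun n j e => ∑ z ∈ antidiagonal e,
          ((Ring.choose (r - j) z.1 : ℚ) : ℂ) •
            A.mode (A.schur u j a) (k + z.1) (A.logCoeff u n (A.schur u z.2 b))]
        refine Finset.sum_congr rfl fun x _ => ?_
        rw [sum_antidiagonal_left_comm fun n i t => ((Ring.choose (r - x.1) i : ℚ) : ℂ) •
            A.mode (A.schur u x.1 a) (k + i) (A.logCoeff u n (A.schur u t b))]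
    _ = ∑ x ∈ antidiagonal s, ∑ y ∈ antidiagonal x.2,
        ((y.2 * Ring.choose (r - x.1) y.1 : ℚ) : ℂ) •
          A.mode (A.schur u x.1 a) (k + y.1) (A.schur u y.2 b) := by
        refine Finset.sum_congr rfl fun x _ => Finset.sum_congr rfl fun y _ => ?_
        rw [← Finset.smul_sum, ← map_sum, ← hu.smul_schur_apply, map_smul, smul_smul]
        push_cast
        rw [mul_comm]
  -- Action on `a`: the inner sum `sum_neg_choose_mul_choose` is independent of the mode of `u`, so
  -- the recursion for `schur u j a` then yields a factor `j`.
  have t2 := calc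
    ∑ x ∈ antidiagonal s, ∑ q ∈ antidiagonal x.1, ∑ y ∈ antidiagonal x.2, ∑ z ∈ antidiagonal y.2,
          (((-1) ^ q.2 * ((q.1 + q.2).choose q.1 : ℚ) * Ring.choose (r - y.1) z.1 : ℚ) : ℂ) •
            A.mode (A.logCoeff u q.1 (A.schur u y.1 a)) (k + ((q.2 + z.1 : ℕ) : ℤ))
              (A.schur u z.2 b)
      = ∑ x ∈ antidiagonal s, ∑ q ∈ antidiagonal x.1, ∑ y ∈ antidiagonal x.2,
          ∑ z ∈ antidiagonal y.1,
          (((-1) ^ z.1 * ((q.1 + z.1).choose q.1 : ℚ) * Ring.choose (r - q.2) z.2 : ℚ) : ℂ) •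
            A.mode (A.logCoeff u q.1 (A.schur u q.2 a)) (k + ((z.1 + z.2 : ℕ) : ℤ))
              (A.schur u y.2 b) := by
        let G : ℕ → ℕ → ℕ → ℕ → ℕ → V := fun p m j i t =>
          (((-1) ^ m * ((p + m).choose p : ℚ) * Ring.choose (r - j) i : ℚ) : ℂ) •
            A.mode (A.logCoeff u p (A.schur u j a)) (k + ((m + i : ℕ) : ℤ)) (A.schur u t b)
        change ∑ x ∈ antidiagonal s, ∑ q ∈ antidiagonal x.1, ∑ y ∈ antidiagonal x.2,
            ∑ z ∈ antidiagonal y.2, G q.1 q.2 y.1 z.1 z.2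
          = ∑ x ∈ antidiagonal s, ∑ q ∈ antidiagonal x.1, ∑ y ∈ antidiagonal x.2,
            ∑ z ∈ antidiagonal y.1, G q.1 z.1 q.2 z.2 y.2
        rw [← sum_antidiagonal_assoc fun p m e => ∑ y ∈ antidiagonal e,
            ∑ z ∈ antidiagonal y.2, G p m y.1 z.1 z.2,
          ← sum_antidiagonal_assoc fun p j e => ∑ y ∈ antidiagonal e,
            ∑ z ∈ antidiagonal y.1, G p z.1 j z.2 y.2]
        refine Finset.sum_congr rfl fun x _ => ?_
        rw [sum_antidiagonal_left_comm fun m j e => ∑ z ∈ antidiagonal e, G x.1 m j z.1 z.2]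
        refine Finset.sum_congr rfl fun y _ => ?_
        rw [sum_antidiagonal_assoc fun m i t => G x.1 m y.1 i t]
    _ = ∑ x ∈ antidiagonal s, ∑ y ∈ antidiagonal x.2,
        ((x.1 * Ring.choose (r - x.1 - 1) y.1 : ℚ) : ℂ) •
          A.mode (A.schur u x.1 a) (k + y.1) (A.schur u y.2 b) := by
        refine Finset.sum_congr rfl fun x _ => ?_
        rw [Finset.sum_comm]
        refine Finset.sum_congr rfl fun y _ => ?_
        have h2 : ∀ q ∈ antidiagonal x.1, ∑ z ∈ antidiagonal y.1,
            (((-1) ^ z.1 * ((q.1 + z.1).choose q.1 : ℚ) * Ring.choose (r - q.2) z.2 : ℚ) : ℂ) •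
              A.mode (A.logCoeff u q.1 (A.schur u q.2 a)) (k + ((z.1 + z.2 : ℕ) : ℤ))
                (A.schur u y.2 b)
            = ((Ring.choose (r - x.1 - 1) y.1 : ℚ) : ℂ) •
              A.mode (A.logCoeff u q.1 (A.schur u q.2 a)) (k + y.1) (A.schur u y.2 b) := by
          intro q hq
          rw [HasAntidiagonal.mem_antidiagonal] at hq
          rw [← sum_neg_choose_mul_choose (r - x.1) q.1 y.1, Rat.cast_sum, Finset.sum_smul]
          refine Finset.sum_congr rfl fun z hz => ?_
          rw [HasAntidiagonal.mem_antidiagonal] at hz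
          have : r - x.1 + q.1 = r - q.2 := by rw [← hq]; push_cast; ring
          rw [this, hz]
        rw [Finset.sum_congr rfl h2, ← Finset.smul_sum, ← LinearMap.sum_apply, ← mode_sum,
          ← hu.smul_schur_apply, mode_smul, LinearMap.smul_apply, smul_smul]
        push_cast
        rw [mul_comm]
  -- Charge term: convolution of `z/(1+z)` with the binomial series.
  have t3 := calc
    ∑ x ∈ antidiagonal s, ∑ y ∈ antidiagonal x.2, ∑ z ∈ antidiagonal y.2,
        ((r * (altCoeff x.1 * Ring.choose (r - y.1) z.1) : ℚ) : ℂ) •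
          A.mode (A.schur u y.1 a) (k + ((x.1 + z.1 : ℕ) : ℤ)) (A.schur u z.2 b)
      = ∑ x ∈ antidiagonal s, ∑ y ∈ antidiagonal x.2, ∑ z ∈ antidiagonal y.1,
        ((r * (altCoeff z.1 * Ring.choose (r - x.1) z.2) : ℚ) : ℂ) •
          A.mode (A.schur u x.1 a) (k + ((z.1 + z.2 : ℕ) : ℤ)) (A.schur u y.2 b) := by
        rw [sum_antidiagonal_left_comm fun n j e => ∑ z ∈ antidiagonal e,
          ((r * (altCoeff n * Ring.choose (r - j) z.1) : ℚ) : ℂ) •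
            A.mode (A.schur u j a) (k + ((n + z.1 : ℕ) : ℤ)) (A.schur u z.2 b)]
        refine Finset.sum_congr rfl fun x _ => ?_
        rw [sum_antidiagonal_assoc fun n i t =>
          ((r * (altCoeff n * Ring.choose (r - x.1) i) : ℚ) : ℂ) •
            A.mode (A.schur u x.1 a) (k + ((n + i : ℕ) : ℤ)) (A.schur u t b)]
    _ = ∑ x ∈ antidiagonal s, ∑ y ∈ antidiagonal x.2,
        ((r * ∑ q ∈ antidiagonal y.1, altCoeff q.1 * Ring.choose (r - x.1) q.2 : ℚ) : ℂ) •
          A.mode (A.schur u x.1 a) (k + y.1) (A.schur u y.2 b) := by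
        refine Finset.sum_congr rfl fun x _ => Finset.sum_congr rfl fun y _ => ?_
        rw [Finset.mul_sum, Rat.cast_sum, Finset.sum_smul]
        refine Finset.sum_congr rfl fun z hz => ?_
        rw [HasAntidiagonal.mem_antidiagonal] at hz
        rw [hz]
  rw [t1, t2, t3, ← Finset.sum_add_distrib, ← Finset.sum_add_distrib, Finset.smul_sum]
  refine Finset.sum_congr rfl fun x hx => ?_
  rw [HasAntidiagonal.mem_antidiagonal] at hx
  rw [← Finset.sum_add_distrib, ← Finset.sum_add_distrib, Finset.smul_sum]
  refine Finset.sum_congr rfl fun y hy => ?_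
  rw [HasAntidiagonal.mem_antidiagonal] at hy
  rw [← add_smul, ← add_smul, smul_smul]
  congr 1
  have h := congrArg (fun q : ℚ => (q : ℂ)) (weighted_choose_identity r x.1 y.1 y.2)
  have hs' : (s : ℂ) = x.1 + y.1 + y.2 := by rw [← hx, ← hy]; push_cast; ring
  rw [hs']
  push_cast at h ⊢
  linear_combination h

end Conjugation

/-! ### Replacing u by -u inverts Δ. -/

section Inverse

theorem IsSemisimplePrimary.neg (hu : A.IsSemisimplePrimary u) : A.IsSemisimplePrimary (-u) where
  L_zero := by rw [map_neg, hu.L_zero]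
  L_pos n hn := by rw [map_neg, hu.L_pos n hn, neg_zero]
  self_mode := by
    obtain ⟨γ, hγ⟩ := hu.self_mode
    exact ⟨γ, fun m hm => by rw [mode_neg, LinearMap.neg_apply, map_neg, neg_neg, hγ m hm]⟩
  semisimple := by
    rw [eq_top_iff, ← hu.semisimple]
    refine iSup_le fun μ => le_trans (fun x hx => ?_) (le_iSup _ (-μ))
    rw [Module.End.mem_eigenspace_iff] at *
    rw [mode_neg, LinearMap.neg_apply, hx, neg_smul]

/-- `exp(E) exp(-E) = 1`. Writing `s = x.1 + x.2` and applying the two recursions, the two halves of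
`s` times the sum cancel. -/
theorem IsSemisimplePrimary.sum_schur_schur_neg (hu : A.IsSemisimplePrimary u) (a : V) (s : ℕ) :
    ∑ x ∈ antidiagonal s, A.schur u x.1 (A.schur (-u) x.2 a) = if s = 0 then a else 0 := by
  rcases Nat.eq_zero_or_pos s with rfl | hs
  · simp [schur_zero]
  · rw [if_neg hs.ne']
    have hs' : (s : ℂ) ≠ 0 := by exact_mod_cast hs.ne'
    refine smul_right_injective V hs' ?_
    change (s : ℂ) • _ = (s : ℂ) • (0 : V)
    have h1 : ∑ x ∈ antidiagonal s, (x.1 : ℂ) • A.schur u x.1 (A.schur (-u) x.2 a)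
        = ∑ x ∈ antidiagonal s, ∑ y ∈ antidiagonal x.1,
          A.logCoeff u y.1 (A.schur u y.2 (A.schur (-u) x.2 a)) :=
      Finset.sum_congr rfl fun x _ => hu.smul_schur_apply _ _
    have h2 : ∑ x ∈ antidiagonal s, (x.2 : ℂ) • A.schur u x.1 (A.schur (-u) x.2 a)
        = -∑ x ∈ antidiagonal s, ∑ y ∈ antidiagonal x.2,
          A.logCoeff u y.1 (A.schur u x.1 (A.schur (-u) y.2 a)) := by
      rw [← Finset.sum_neg_distrib]
      refine Finset.sum_congr rfl fun x _ => ?_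
      rw [← map_smul, hu.neg.smul_schur_apply, map_sum, ← Finset.sum_neg_distrib]
      refine Finset.sum_congr rfl fun y _ => ?_
      rw [logCoeff_neg, LinearMap.neg_apply, map_neg, hu.commute_logCoeff_schur]
    rw [← sum_antidiagonal_assoc fun n j t =>
        A.logCoeff u n (A.schur u j (A.schur (-u) t a))] at h1
    rw [← sum_antidiagonal_left_comm fun n j t =>
        A.logCoeff u n (A.schur u j (A.schur (-u) t a)), ← h1, eq_neg_iff_add_eq_zero] at h2
    rw [smul_zero, ← h2, ← Finset.sum_add_distrib, Finset.smul_sum]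
    refine Finset.sum_congr rfl fun x hx => ?_
    rw [HasAntidiagonal.mem_antidiagonal] at hx
    rw [← add_smul, ← hx]
    push_cast
    rw [add_comm]

theorem chargeSpace_neg (r : ℚ) : A.chargeSpace (-u) r = A.chargeSpace u (-r) := by
  ext x
  rw [chargeSpace, chargeSpace, Module.End.mem_eigenspace_iff, Module.End.mem_eigenspace_iff,
    mode_neg, LinearMap.neg_apply, neg_eq_iff_eq_neg]
  push_cast
  rw [neg_smul]

theorem IsRationalSemisimplePrimary.neg (hu : A.IsRationalSemisimplePrimary u) :
    A.IsRationalSemisimplePrimary (-u) where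
  toIsSemisimplePrimary := hu.toIsSemisimplePrimary.neg
  rational := by
    obtain ⟨T, hT, h⟩ := hu.rational
    refine ⟨T, hT, fun μ hμ => ?_⟩
    obtain ⟨x, hx⟩ := hμ.exists_hasEigenvector
    have hx2 : (A.mode u 0).HasEigenvalue (-μ) := by
      refine Module.End.hasEigenvalue_of_hasEigenvector (x := x) ⟨?_, hx.2⟩
      have := hx.apply_eq_smul
      rw [mode_neg, LinearMap.neg_apply, neg_eq_iff_eq_neg] at this
      rw [Module.End.mem_eigenspace_iff, this, neg_smul]
    obtain ⟨k, hk⟩ := h _ hx2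
    refine ⟨-k, ?_⟩
    rw [← neg_neg μ, hk]
    push_cast
    ring

end Inverse

/-! ### The decomposition of V by charge. -/

section Charge

theorem charge_induction (hu : A.IsRationalSemisimplePrimary u) {P : V → Prop} (zero : P 0)
    (add : ∀ a b, P a → P b → P (a + b)) (mem : ∀ r, ∀ a ∈ A.chargeSpace u r, P a) (a : V) :
    P a := by
  have ha : a ∈ ⨆ r, A.chargeSpace u r := hu.isInternal.submodule_iSup_eq_top ▸ Submodule.mem_top
  exact Submodule.iSup_induction _ (motive := P) ha mem zero add

theorem chargeProj_of_mem (hu : A.IsRationalSemisimplePrimary u) {r : ℚ} {a : V}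
    (ha : a ∈ A.chargeSpace u r) (q : ℚ) : chargeProj hu q a = if q = r then a else 0 := by
  have h1 : (chargeEquiv hu).symm a
      = DirectSum.lof ℂ ℚ (fun r => A.chargeSpace u r) r ⟨a, ha⟩ := by
    rw [LinearEquiv.symm_apply_eq]
    exact (DirectSum.coeLinearMap_lof (A.chargeSpace u) r ⟨a, ha⟩).symm
  simp only [chargeProj, LinearMap.comp_apply, LinearEquiv.coe_coe, h1]
  split_ifs with h
  · subst h
    simp [DirectSum.component.lof_self]
  · rw [DirectSum.component.of]
    simp [Ne.symm h]

theorem chargeProj_mem (hu : A.IsRationalSemisimplePrimary u) (q : ℚ) (a : V) :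
    chargeProj hu q a ∈ A.chargeSpace u q := by
  simp [chargeProj]

theorem exists_eq_sum_chargeProj (hu : A.IsRationalSemisimplePrimary u) (a : V) :
    ∃ s : Finset ℚ, a = ∑ r ∈ s, chargeProj hu r a := by
  classical
  refine ⟨((chargeEquiv hu).symm a).support, ?_⟩
  have h := DirectSum.coeLinearMap_eq_dfinsuppSum (A.chargeSpace u) ((chargeEquiv hu).symm a)
  have h2 : DirectSum.coeLinearMap (A.chargeSpace u) ((chargeEquiv hu).symm a) = a :=
    (chargeEquiv hu).apply_symm_apply a
  rw [h2] at h
  exact h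

theorem map_mem_chargeSpace {h : A.aut} (hh : (h : V ≃ₗ[ℂ] V) u = u) {r : ℚ} {a : V}
    (ha : a ∈ A.chargeSpace u r) : (h : V ≃ₗ[ℂ] V) a ∈ A.chargeSpace u r := by
  rw [chargeSpace, Module.End.mem_eigenspace_iff] at *
  have := h.2.2.2 u a 0
  rw [ha, hh, map_smul] at this
  exact this.symm

theorem map_chargeProj (hu : A.IsRationalSemisimplePrimary u) {h : A.aut}
    (hh : (h : V ≃ₗ[ℂ] V) u = u) (q : ℚ) (a : V) :
    (h : V ≃ₗ[ℂ] V) (chargeProj hu q a) = chargeProj hu q ((h : V ≃ₗ[ℂ] V) a) := by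
  refine charge_induction hu (P := fun a => (h : V ≃ₗ[ℂ] V) (chargeProj hu q a)
    = chargeProj hu q ((h : V ≃ₗ[ℂ] V) a)) (by simp) (fun a b ha hb => ?_) (fun r a ha => ?_) a
  · simp only [map_add, ha, hb]
  · rw [chargeProj_of_mem hu ha, chargeProj_of_mem hu (map_mem_chargeSpace hh ha)]
    split_ifs <;> simp

end Charge

/-! ### The coefficients of `Δ(u,z)a`. -/

section DeltaCoeff

variable (hu : A.IsRationalSemisimplePrimary u)

theorem finite_support_chargeProj_schur (q : ℚ) (a : V) :
    (fun s : ℕ => chargeProj hu (q + s) (A.schur u s a)).HasFiniteSupport := by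
  obtain ⟨N, hN⟩ := hu.exists_schur_eq_zero a
  refine (Set.finite_lt_nat N).subset fun s hs => ?_
  by_contra hc
  exact hs (by simp [hN s (not_lt.1 hc)])

theorem deltaCoeff_add (q : ℚ) (a b : V) :
    deltaCoeff hu q (a + b) = deltaCoeff hu q a + deltaCoeff hu q b := by
  simp only [deltaCoeff, map_add]
  exact finsum_add_distrib (finite_support_chargeProj_schur hu q a)
    (finite_support_chargeProj_schur hu q b)

theorem deltaCoeff_smul (q : ℚ) (c : ℂ) (a : V) :
    deltaCoeff hu q (c • a) = c • deltaCoeff hu q a := by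
  simp only [deltaCoeff, map_smul]
  rw [smul_finsum]

theorem deltaCoeff_of_mem {r : ℚ} {a : V} (ha : a ∈ A.chargeSpace u r) (q : ℚ) :
    deltaCoeff hu q a = ∑ᶠ s : ℕ, if q = r - s then A.schur u s a else 0 := by
  refine finsum_congr fun s => ?_
  rw [chargeProj_of_mem hu (hu.schur_mem_chargeSpace ha s)]
  simp only [eq_sub_iff_add_eq]

theorem deltaCoeff_eq_sum {r : ℚ} {a : V} (ha : a ∈ A.chargeSpace u r) {B : ℕ}
    (hB : ∀ s, B ≤ s → A.schur u s a = 0) (q : ℚ) :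
    deltaCoeff hu q a = ∑ s ∈ range B, if q = r - s then A.schur u s a else 0 := by
  rw [deltaCoeff_of_mem hu ha, finsum_eq_sum_of_support_subset]
  intro s hs
  by_contra hc
  refine hs ?_
  simp [hB s (by simpa using hc)]

theorem finite_support_deltaCoeff (a : V) : (fun q => deltaCoeff hu q a).HasFiniteSupport := by
  refine charge_induction hu (P := fun a => (fun q => deltaCoeff hu q a).HasFiniteSupport)
    ?_ (fun a b ha hb => ?_) (fun r a ha => ?_) a
  · have : (fun q => deltaCoeff hu q 0) = fun _ => 0 := by ext q; simp [deltaCoeff]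
    rw [this]
    exact Set.Finite.subset Set.finite_empty fun q hq => hq rfl
  · refine (Set.Finite.union ha hb).subset fun q hq => ?_
    by_contra hc
    simp only [Set.mem_union, Function.mem_support, not_or, not_not] at hc
    exact hq (by simp only [deltaCoeff_add, hc, add_zero])
  · obtain ⟨B, hB⟩ := hu.exists_schur_eq_zero a
    refine ((range B).image fun s : ℕ => r - s).finite_toSet.subset fun q hq => ?_
    by_contra hc
    refine hq ?_
    simp only [deltaCoeff_eq_sum hu ha hB]
    refine Finset.sum_eq_zero fun s hs => if_neg fun h => hc ?_
    simp only [coe_image, Set.mem_image]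
    exact ⟨s, by simpa using hs, h.symm⟩

theorem map_deltaCoeff {h : A.aut} (hh : (h : V ≃ₗ[ℂ] V) u = u) (q : ℚ) (a : V) :
    (h : V ≃ₗ[ℂ] V) (deltaCoeff hu q a) = deltaCoeff hu q ((h : V ≃ₗ[ℂ] V) a) := by
  have := (h : V ≃ₗ[ℂ] V).toAddEquiv.map_finsum
    (fun s : ℕ => chargeProj hu (q + s) (A.schur u s a))
  refine this.trans (finsum_congr fun s => ?_)
  change (h : V ≃ₗ[ℂ] V) (chargeProj hu (q + s) (A.schur u s a)) = _
  rw [map_chargeProj hu hh, hu.map_schur h hh]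

end DeltaCoeff

/-! ### The transformed vertex operators. -/

section DeltaY

variable {W : Type w} [AddCommGroup W] [Module ℂ W] (hu : A.IsRationalSemisimplePrimary u)

theorem finite_support_deltaMode (Y : V →ₗ[ℂ] ℚ → Module.End ℂ W) (a : V) (n : ℚ) :
    (fun q => Y (deltaCoeff hu q a) (n + q)).HasFiniteSupport := by
  refine (finite_support_deltaCoeff hu a).subset fun q hq => ?_
  by_contra hc
  rw [Function.mem_support, not_not] at hc
  exact hq (by simp [hc])

/-- The vertex operators `Y(Δ(u,z)a,z)`. -/
def deltaY (Y : V →ₗ[ℂ] ℚ → Module.End ℂ W) : V →ₗ[ℂ] ℚ → Module.End ℂ W where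
  toFun a n := ∑ᶠ q, Y (deltaCoeff hu q a) (n + q)
  map_add' a b := by
    ext1 n
    simp only [deltaCoeff_add, map_add, Pi.add_apply]
    exact finsum_add_distrib (finite_support_deltaMode hu Y a n)
      (finite_support_deltaMode hu Y b n)
  map_smul' c a := by
    ext1 n
    simp only [deltaCoeff_smul, map_smul, Pi.smul_apply, RingHom.id_apply]
    rw [smul_finsum]

theorem deltaY_apply (Y : V →ₗ[ℂ] ℚ → Module.End ℂ W) (a : V) (n : ℚ) (x : W) :
    deltaY hu Y a n x = ∑ᶠ q, Y (deltaCoeff hu q a) (n + q) x :=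
  (LinearMap.applyₗ x : Module.End ℂ W →ₗ[ℂ] W).toAddMonoidHom.map_finsum
    (finite_support_deltaMode hu Y a n)

/-- The working form of `deltaY`: `z^(r-s)` in `Δ(u,z)a` shifts the mode index by `r - s`. -/
theorem deltaY_of_mem (Y : V →ₗ[ℂ] ℚ → Module.End ℂ W) {r : ℚ} {a : V}
    (ha : a ∈ A.chargeSpace u r) {B : ℕ} (hB : ∀ s, B ≤ s → A.schur u s a = 0) (n : ℚ) :
    deltaY hu Y a n = ∑ s ∈ range B, Y (A.schur u s a) (n + r - s) := by
  have h1 : ∀ q, Y (deltaCoeff hu q a) (n + q)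
      = ∑ s ∈ range B, if q = r - s then Y (A.schur u s a) (n + q) else 0 := by
    intro q
    rw [deltaCoeff_eq_sum hu ha hB, map_sum, Finset.sum_apply]
    refine Finset.sum_congr rfl fun s _ => ?_
    split_ifs <;> simp
  change ∑ᶠ q, Y (deltaCoeff hu q a) (n + q) = _
  simp only [h1]
  rw [finsum_sum_comm]
  · refine Finset.sum_congr rfl fun s _ => ?_
    rw [finsum_eq_single _ (r - (s : ℚ)) fun q hq => if_neg hq, if_pos rfl, add_sub_assoc]
  · intro s _
    refine (Set.finite_singleton (r - (s : ℚ))).subset fun q hq => ?_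
    by_contra hc
    exact hq (if_neg hc)

/-- The relation `u = -u'` is a hypothesis so that one statement covers both orders of composition.
-/
theorem deltaY_deltaY {u' : V} (hu' : A.IsRationalSemisimplePrimary u') (h : u = -u')
    (Y : V →ₗ[ℂ] ℚ → Module.End ℂ W) : deltaY hu' (deltaY hu Y) = Y := by
  have h' : u' = -u := by rw [h, neg_neg]
  ext1 a
  refine charge_induction hu (P := fun a => deltaY hu' (deltaY hu Y) a = Y a) (by simp)
    (fun a b ha hb => by rw [map_add, map_add, ha, hb]) (fun r a ha => ?_) a
  ext1 n
  have ha' : a ∈ A.chargeSpace u' (-r) := by rwa [h', chargeSpace_neg, neg_neg]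
  obtain ⟨B, hB⟩ := hu'.exists_schur_eq_zero a
  choose C hC using fun s => hu.exists_schur_eq_zero (A.schur u' s a)
  obtain ⟨D, hD⟩ := ((range B).image C).exists_le
  have hD' : ∀ s t, D ≤ t → A.schur u t (A.schur u' s a) = 0 := by
    intro s t ht
    by_cases hs : s < B
    · exact hC s t (le_trans (hD _ (mem_image_of_mem C (mem_range.2 hs))) ht)
    · rw [hB s (not_lt.1 hs), map_zero]
  have hmem : ∀ s, A.schur u' s a ∈ A.chargeSpace u r := fun s => by
    have := hu'.schur_mem_chargeSpace ha' s
    rwa [h', chargeSpace_neg, neg_neg, ← h'] at this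
  rw [deltaY_of_mem hu' _ ha' hB]
  calc ∑ s ∈ range B, deltaY hu Y (A.schur u' s a) (n + -r - s)
      = ∑ s ∈ range B, ∑ t ∈ range D,
          Y (A.schur u t (A.schur u' s a)) (n - ((t + s : ℕ) : ℚ)) := by
        refine Finset.sum_congr rfl fun s _ => ?_
        rw [deltaY_of_mem hu Y (hmem s) (hD' s)]
        refine Finset.sum_congr rfl fun t _ => ?_
        have : n + -r - s + r - t = n - ((t + s : ℕ) : ℚ) := by push_cast; ring
        rw [this]
    _ = ∑ e ∈ range (D + B + 1), ∑ x ∈ antidiagonal e,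
          Y (A.schur u x.1 (A.schur u' x.2 a)) (n - ((x.1 + x.2 : ℕ) : ℚ)) := by
        rw [Finset.sum_comm]
        refine (sum_range_sum_antidiagonal
          (fun t s => Y (A.schur u t (A.schur u' s a)) (n - ((t + s : ℕ) : ℚ))) ?_
            (Nat.le_succ _)).symm
        rintro t s (ht | hs)
        · simp [hD' s t ht]
        · simp [hB s hs]
    _ = ∑ e ∈ range (D + B + 1), if e = 0 then Y a n else 0 := by
        refine Finset.sum_congr rfl fun e _ => ?_
        have h1 : ∀ x ∈ antidiagonal e,
            Y (A.schur u x.1 (A.schur u' x.2 a)) (n - ((x.1 + x.2 : ℕ) : ℚ))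
              = Y (A.schur u x.1 (A.schur u' x.2 a)) (n - (e : ℚ)) := by
          intro x hx
          rw [HasAntidiagonal.mem_antidiagonal.1 hx]
        rw [Finset.sum_congr rfl h1, ← Finset.sum_apply, ← map_sum, h', hu.sum_schur_schur_neg]
        split_ifs with he
        · simp [he]
        · simp
    _ = Y a n := by simp

theorem deltaY_mem (Y : V →ₗ[ℂ] ℚ → Module.End ℂ W) {S : Submodule ℂ W}
    (hS : ∀ (a : V) (n : ℚ), ∀ x ∈ S, Y a n x ∈ S) (a : V) (n : ℚ) {x : W} (hx : x ∈ S) :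
    deltaY hu Y a n x ∈ S := by
  rw [deltaY_apply]
  exact finsum_induction (· ∈ S) S.zero_mem (fun _ _ => S.add_mem) fun q => hS _ _ x hx

/-- Used with `h = 1` for isomorphisms and with general `h` for stability. -/
theorem deltaY_intertwine {W' : Type w} [AddCommGroup W'] [Module ℂ W']
    {Y : V →ₗ[ℂ] ℚ → Module.End ℂ W} {Y' : V →ₗ[ℂ] ℚ → Module.End ℂ W'} {h : A.aut}
    (hh : (h : V ≃ₗ[ℂ] V) u = u) (f : W ≃ₗ[ℂ] W')
    (hf : ∀ (a : V) (n : ℚ) (x : W), f (Y a n x) = Y' ((h : V ≃ₗ[ℂ] V) a) n (f x))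
    (a : V) (n : ℚ) (x : W) :
    f (deltaY hu Y a n x) = deltaY hu Y' ((h : V ≃ₗ[ℂ] V) a) n (f x) := by
  rw [deltaY_apply, deltaY_apply]
  refine (f.toAddEquiv.map_finsum _).trans (finsum_congr fun q => ?_)
  rw [← map_deltaCoeff hu hh]
  exact hf _ _ _

theorem deltaY_vacuum (Y : V →ₗ[ℂ] ℚ → Module.End ℂ W) (n : ℚ) :
    deltaY hu Y A.vacuum n = Y A.vacuum n := by
  rw [deltaY_of_mem hu Y (vacuum_mem_chargeSpace u) (B := 1) fun s hs => hu.schur_vacuum hs]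
  simp [schur_zero]

/-- The truncation condition for a family of vertex operators. -/
def IsTruncated (Y : V →ₗ[ℂ] ℚ → Module.End ℂ W) : Prop :=
  ∀ (a : V) (w : W), ∃ N : ℚ, ∀ n : ℚ, N ≤ n → Y a n w = 0

theorem isTruncated_deltaY {Y : V →ₗ[ℂ] ℚ → Module.End ℂ W} (hY : IsTruncated Y) :
    IsTruncated (deltaY hu Y) := by
  intro a w
  have hfin := finite_support_deltaCoeff hu a
  choose N hN using fun q => hY (deltaCoeff hu q a) w
  obtain ⟨D, hD⟩ := (hfin.toFinset.image fun q => N q - q).exists_le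
  refine ⟨D, fun n hn => ?_⟩
  rw [deltaY_apply]
  refine finsum_eq_zero_of_forall_eq_zero fun q => ?_
  by_cases hq : deltaCoeff hu q a = 0
  · simp [hq]
  · have := hD (N q - q) (mem_image_of_mem _ (hfin.mem_toFinset.2 hq))
    exact hN q _ (by linarith)

end DeltaY

/-! ### The twisted Jacobi identity for the transformed operators. -/

section Jacobi

variable {W : Type w} [AddCommGroup W] [Module ℂ W]

/-- The summands on the left-hand side of the twisted Jacobi identity. -/
def jacobiLeft (Y : V →ₗ[ℂ] ℚ → Module.End ℂ W) (a b : V) (l : ℤ) (m n : ℚ) (w : W) (i : ℕ) : W :=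
  ((-1 : ℂ) ^ i * (Ring.choose l i : ℤ)) •
    (Y a (m + l - i) (Y b (n + i) w) - ((-1 : ℂ) ^ l) • Y b (n + l - i) (Y a (m + i) w))

/-- The summands on the right-hand side of the twisted Jacobi identity. -/
def jacobiRight (A : VertexOperatorAlgebra V) (Y : V →ₗ[ℂ] ℚ → Module.End ℂ W) (a b : V)
    (l : ℤ) (m n : ℚ) (w : W) (i : ℕ) : W :=
  ((Ring.choose m i : ℚ) : ℂ) • Y (A.mode a (l + i) b) (m + n - i) w

/-- A coefficient of the twisted Jacobi identity. -/
def TwistedJacobi (A : VertexOperatorAlgebra V) (Y : V →ₗ[ℂ] ℚ → Module.End ℂ W) (a b : V)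
    (l : ℤ) (m n : ℚ) (w : W) : Prop :=
  ∑ᶠ i : ℕ, jacobiLeft Y a b l m n w i = ∑ᶠ i : ℕ, jacobiRight A Y a b l m n w i

theorem finite_support_of_le {M : Type*} [Zero M] {f : ℕ → M} {N : ℕ}
    (h : ∀ i, N ≤ i → f i = 0) : f.HasFiniteSupport :=
  (Set.finite_lt_nat N).subset fun i hi => by
    by_contra hc
    exact hi (h i (not_lt.1 hc))

theorem finite_support_jacobiLeft {Y : V →ₗ[ℂ] ℚ → Module.End ℂ W} (hY : IsTruncated Y)
    (a b : V) (l : ℤ) (m n : ℚ) (w : W) : (jacobiLeft Y a b l m n w).HasFiniteSupport := by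
  obtain ⟨N, hN⟩ := hY a w
  obtain ⟨K, hK⟩ := hY b w
  refine finite_support_of_le (N := max ⌈N - m⌉₊ ⌈K - n⌉₊) fun i hi => ?_
  have h1 : N - m ≤ i := Nat.ceil_le.1 (le_trans (le_max_left _ _) hi)
  have h2 : K - n ≤ i := Nat.ceil_le.1 (le_trans (le_max_right _ _) hi)
  rw [jacobiLeft, hN _ (by linarith), hK _ (by linarith)]
  simp

theorem exists_mode_nat_eq_zero (A : VertexOperatorAlgebra V) (a b : V) (l : ℤ) :
    ∃ I : ℕ, ∀ i : ℕ, I ≤ i → A.mode a (l + i) b = 0 := by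
  obtain ⟨N, hN⟩ := exists_mode_eq_zero (A := A) a b
  exact ⟨(N - l).toNat, fun i hi => hN _ (by omega)⟩

theorem finite_support_jacobiRight (Y : V →ₗ[ℂ] ℚ → Module.End ℂ W)
    (a b : V) (l : ℤ) (m n : ℚ) (w : W) : (jacobiRight A Y a b l m n w).HasFiniteSupport := by
  obtain ⟨I, hI⟩ := exists_mode_nat_eq_zero A a b l
  exact finite_support_of_le (N := I) fun i hi => by simp [jacobiRight, hI i hi]

theorem TwistedJacobi.add_left {Y : V →ₗ[ℂ] ℚ → Module.End ℂ W} (hY : IsTruncated Y)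
    {a a' b : V} {l : ℤ} {m n : ℚ} {w : W} (h : TwistedJacobi A Y a b l m n w)
    (h' : TwistedJacobi A Y a' b l m n w) : TwistedJacobi A Y (a + a') b l m n w := by
  have h1 : jacobiLeft Y (a + a') b l m n w
      = fun i => jacobiLeft Y a b l m n w i + jacobiLeft Y a' b l m n w i := by
    ext i
    simp only [jacobiLeft, map_add, Pi.add_apply, LinearMap.add_apply]
    module
  have h2 : jacobiRight A Y (a + a') b l m n w
      = fun i => jacobiRight A Y a b l m n w i + jacobiRight A Y a' b l m n w i := by
    ext i
    simp only [jacobiRight, mode_add, map_add, Pi.add_apply, LinearMap.add_apply, smul_add]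
  rw [TwistedJacobi, h1, h2, finsum_add_distrib (finite_support_jacobiLeft hY _ _ _ _ _ _)
    (finite_support_jacobiLeft hY _ _ _ _ _ _),
    finsum_add_distrib (finite_support_jacobiRight _ _ _ _ _ _ _)
    (finite_support_jacobiRight _ _ _ _ _ _ _), h, h']

theorem TwistedJacobi.add_right {Y : V →ₗ[ℂ] ℚ → Module.End ℂ W} (hY : IsTruncated Y)
    {a b b' : V} {l : ℤ} {m n : ℚ} {w : W} (h : TwistedJacobi A Y a b l m n w)
    (h' : TwistedJacobi A Y a b' l m n w) : TwistedJacobi A Y a (b + b') l m n w := by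
  have h1 : jacobiLeft Y a (b + b') l m n w
      = fun i => jacobiLeft Y a b l m n w i + jacobiLeft Y a b' l m n w i := by
    ext i
    simp only [jacobiLeft, map_add, Pi.add_apply, LinearMap.add_apply]
    module
  have h2 : jacobiRight A Y a (b + b') l m n w
      = fun i => jacobiRight A Y a b l m n w i + jacobiRight A Y a b' l m n w i := by
    ext i
    simp only [jacobiRight, map_add, Pi.add_apply, LinearMap.add_apply, smul_add]
  rw [TwistedJacobi, h1, h2, finsum_add_distrib (finite_support_jacobiLeft hY _ _ _ _ _ _)
    (finite_support_jacobiLeft hY _ _ _ _ _ _),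
    finsum_add_distrib (finite_support_jacobiRight _ _ _ _ _ _ _)
    (finite_support_jacobiRight _ _ _ _ _ _ _), h, h']

theorem TwistedJacobi.zero_left (Y : V →ₗ[ℂ] ℚ → Module.End ℂ W) (b : V) (l : ℤ) (m n : ℚ)
    (w : W) : TwistedJacobi A Y 0 b l m n w := by
  simp [TwistedJacobi, jacobiLeft, jacobiRight, mode_zero]

theorem TwistedJacobi.zero_right (Y : V →ₗ[ℂ] ℚ → Module.End ℂ W) (a : V) (l : ℤ) (m n : ℚ)
    (w : W) : TwistedJacobi A Y a 0 l m n w := by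
  simp [TwistedJacobi, jacobiLeft, jacobiRight]

variable (hu : A.IsRationalSemisimplePrimary u)

theorem jacobiLeft_deltaY {Y : V →ₗ[ℂ] ℚ → Module.End ℂ W} {r ρ : ℚ} {a b : V}
    (ha : a ∈ A.chargeSpace u r) (hb : b ∈ A.chargeSpace u ρ) {B : ℕ}
    (hBa : ∀ s, B ≤ s → A.schur u s a = 0) (hBb : ∀ s, B ≤ s → A.schur u s b = 0)
    (l : ℤ) (m n : ℚ) (w : W) (i : ℕ) :
    jacobiLeft (deltaY hu Y) a b l m n w i = ∑ x ∈ range B ×ˢ range B,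
      jacobiLeft Y (A.schur u x.1 a) (A.schur u x.2 b) l (m + r - x.1) (n + ρ - x.2) w i := by
  have e1 : ∀ j : ℕ, m + l - i + r - j = m + r - j + l - i := fun j => by ring
  have e2 : ∀ j : ℕ, n + l - i + ρ - j = n + ρ - j + l - i := fun j => by ring
  have e3 : ∀ j : ℕ, n + i + ρ - j = n + ρ - j + i := fun j => by ring
  have e4 : ∀ j : ℕ, m + i + r - j = m + r - j + i := fun j => by ring
  simp only [jacobiLeft]
  rw [← Finset.smul_sum, Finset.sum_sub_distrib, ← Finset.smul_sum, Finset.sum_product,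
    Finset.sum_product_right]
  simp only [deltaY_of_mem hu Y ha hBa, deltaY_of_mem hu Y hb hBb, LinearMap.sum_apply, map_sum,
    e1, e2, e3, e4]
  congr 2
  · rw [Finset.sum_comm]
  · rw [Finset.sum_comm]

/-- Both sides split into sums over pairs `(j, t)` of coefficients for `Y`, with `l` unchanged. On
the left this is bilinearity; on the right it is the conjugation formula. -/
theorem twistedJacobi_deltaY_of_mem {Y : V →ₗ[ℂ] ℚ → Module.End ℂ W} (hY : IsTruncated Y)
    {r ρ : ℚ} {a b : V} (ha : a ∈ A.chargeSpace u r) (hb : b ∈ A.chargeSpace u ρ)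
    (l : ℤ) (m n : ℚ) (w : W)
    (hJ : ∀ (j t : ℕ), TwistedJacobi A Y (A.schur u j a) (A.schur u t b) l (m + r - j)
      (n + ρ - t) w) :
    TwistedJacobi A (deltaY hu Y) a b l m n w := by
  obtain ⟨Ba, hBa'⟩ := hu.exists_schur_eq_zero a
  obtain ⟨Bb, hBb'⟩ := hu.exists_schur_eq_zero b
  obtain ⟨B, hBa, hBb⟩ : ∃ B : ℕ, (∀ s, B ≤ s → A.schur u s a = 0) ∧
      ∀ s, B ≤ s → A.schur u s b = 0 :=
    ⟨max Ba Bb, fun s hs => hBa' s (le_trans (le_max_left _ _) hs),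
      fun s hs => hBb' s (le_trans (le_max_right _ _) hs)⟩
  choose I' hI' using fun x : ℕ × ℕ =>
    exists_mode_nat_eq_zero A (A.schur u x.1 a) (A.schur u x.2 b) l
  obtain ⟨I, hI⟩ := ((range B ×ˢ range B).image I').exists_le
  have hzero : ∀ j t i : ℕ, B ≤ j ∨ B ≤ t ∨ I ≤ i →
      A.mode (A.schur u j a) (l + i) (A.schur u t b) = 0 := by
    intro j t i h
    by_cases hj : B ≤ j
    · simp [hBa j hj, mode_zero]
    by_cases ht : B ≤ t
    · simp [hBb t ht]
    have hi : I ≤ i := by tauto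
    refine hI' (j, t) i (le_trans (hI _ (mem_image_of_mem I' ?_)) hi)
    simp only [mem_product, mem_range]
    omega
  -- In `s = j + p + t`, nonzero terms need `j < B`, `p < I` and `t < B`.
  have hmode : ∀ i : ℕ, ∀ s, B + (I + B) ≤ s → A.schur u s (A.mode a (l + i) b) = 0 := by
    intro i s hs
    rw [hu.schur_mode ha]
    refine Finset.sum_eq_zero fun x hx => Finset.sum_eq_zero fun y hy => ?_
    rw [HasAntidiagonal.mem_antidiagonal] at hx hy
    have := hzero x.1 y.2 (i + y.1) (by omega)
    rw [Nat.cast_add, ← add_assoc] at this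
    rw [this, smul_zero]
  have hmode0 : ∀ i : ℕ, I ≤ i → A.mode a (l + i) b = 0 := by
    intro i hi
    have := hzero 0 0 i (by omega)
    simpa [schur_zero] using this
  let F : ℕ → ℕ → ℕ → ℕ → W := fun i j p t =>
    ((Ring.choose m i * Ring.choose (r - j) p : ℚ) : ℂ) •
      Y (A.mode (A.schur u j a) (l + ((i + p : ℕ) : ℤ)) (A.schur u t b))
        (m + n + r + ρ - j - t - ((i + p : ℕ) : ℚ)) w
  have hF : ∀ i j p t, B ≤ j ∨ B ≤ t ∨ I ≤ i + p → F i j p t = 0 := by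
    intro i j p t h
    simp only [F, hzero j t (i + p) h, map_zero, Pi.zero_apply, LinearMap.zero_apply, smul_zero]
  have hright : ∀ i, jacobiRight A (deltaY hu Y) a b l m n w i
      = ∑ j ∈ range B, ∑ p ∈ range I, ∑ t ∈ range B, F i j p t := by
    intro i
    calc jacobiRight A (deltaY hu Y) a b l m n w i
        = ∑ s ∈ range (B + (I + B)), ∑ x ∈ antidiagonal s, ∑ y ∈ antidiagonal x.2,
            F i x.1 y.1 y.2 := by
          rw [jacobiRight, deltaY_of_mem hu Y (mode_mem_chargeSpace ha hb _) (hmode i),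
            LinearMap.sum_apply, Finset.smul_sum]
          refine Finset.sum_congr rfl fun s _ => ?_
          rw [hu.schur_mode ha, map_sum, Finset.sum_apply, LinearMap.sum_apply, Finset.smul_sum]
          refine Finset.sum_congr rfl fun x hx => ?_
          rw [map_sum, Finset.sum_apply, LinearMap.sum_apply, Finset.smul_sum]
          refine Finset.sum_congr rfl fun y hy => ?_
          rw [HasAntidiagonal.mem_antidiagonal] at hx hy
          have e1 : m + n - i + (r + ρ) - s
              = m + n + r + ρ - x.1 - y.2 - ((i + y.1 : ℕ) : ℚ) := by
            rw [← hx, ← hy]; push_cast; ring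
          have e2 : l + i + (y.1 : ℤ) = l + ((i + y.1 : ℕ) : ℤ) := by push_cast; ring
          simp only [F]
          rw [e1, e2, map_smul, Pi.smul_apply, LinearMap.smul_apply, smul_smul]
          push_cast
          rfl
      _ = ∑ j ∈ range B, ∑ y ∈ range (I + B), ∑ z ∈ antidiagonal y, F i j z.1 z.2 := by
          refine sum_range_sum_antidiagonal
            (fun j y => ∑ z ∈ antidiagonal y, F i j z.1 z.2) (fun j y h => ?_) le_rfl
          refine Finset.sum_eq_zero fun z hz => hF _ _ _ _ ?_
          rw [HasAntidiagonal.mem_antidiagonal] at hz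
          omega
      _ = ∑ j ∈ range B, ∑ p ∈ range I, ∑ t ∈ range B, F i j p t := by
          refine Finset.sum_congr rfl fun j _ => ?_
          refine sum_range_sum_antidiagonal (F i j) (fun p t h => hF _ _ _ _ ?_) le_rfl
          omega
  have hR : ∑ᶠ i, jacobiRight A (deltaY hu Y) a b l m n w i
      = ∑ j ∈ range B, ∑ t ∈ range B, ∑ e ∈ range (I + I), ∑ z ∈ antidiagonal e,
          F z.1 j z.2 t := by
    rw [finsum_eq_sum_of_support_subset (s := range I)]
    · simp only [hright]
      rw [Finset.sum_comm]
      refine Finset.sum_congr rfl fun j _ => ?_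
      have h1 : ∀ i ∈ range I, ∑ p ∈ range I, ∑ t ∈ range B, F i j p t
          = ∑ t ∈ range B, ∑ p ∈ range I, F i j p t := fun i _ => Finset.sum_comm
      rw [Finset.sum_congr rfl h1, Finset.sum_comm]
      refine Finset.sum_congr rfl fun t _ => ?_
      refine (sum_range_sum_antidiagonal (fun i p => F i j p t)
        (fun i p h => hF _ _ _ _ ?_) le_rfl).symm
      omega
    · intro i hi
      by_contra hc
      exact hi (by simp [jacobiRight, hmode0 i (by simpa using hc)])
  rw [TwistedJacobi, hR]
  simp only [jacobiLeft_deltaY hu ha hb hBa hBb]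
  rw [finsum_sum_comm _ _ fun x _ => finite_support_jacobiLeft hY _ _ _ _ _ _,
    Finset.sum_product]
  refine Finset.sum_congr rfl fun j _ => Finset.sum_congr rfl fun t _ => ?_
  rw [hJ j t, finsum_eq_sum_of_support_subset (s := range (I + I))]
  · refine Finset.sum_congr rfl fun e _ => ?_
    rw [jacobiRight]
    have e1 : m + r - j = m + (r - j) := by ring
    have e2 : m + r - j + (n + ρ - t) - e = m + n + r + ρ - j - t - e := by ring
    -- Vandermonde for `m + (r - j)` recombines the binomials of the Jacobi identity and of the
    -- conjugation formula.
    rw [e2, e1, choose_add_eq_sum, Rat.cast_sum, Finset.sum_smul]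
    refine Finset.sum_congr rfl fun z hz => ?_
    rw [HasAntidiagonal.mem_antidiagonal] at hz
    simp only [F, hz]
  · intro i hi
    by_contra hc
    have hc' : I + I ≤ i := by simpa using hc
    exact hi (by simp [jacobiRight, hzero j t i (by omega)])

end Jacobi

/-! ### Transforming twisted modules and their isomorphism classes. -/

section Transform

variable {g g' : A.aut}

/-- The relation `g' = g σ(u)` between automorphisms, on the eigenvectors of `u_(0)`. -/
def IsSigmaShift (u : V) (g g' : A.aut) : Prop :=
  ∀ (r : ℚ), ∀ a ∈ A.chargeSpace u r,
    (g' : V ≃ₗ[ℂ] V) a = Complex.exp (-(2 * Real.pi * Complex.I * (r : ℂ))) • (g : V ≃ₗ[ℂ] V) a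

theorem isSigmaShift_mul_sigma (hu : A.IsRationalSemisimplePrimary u) (g : A.aut) :
    IsSigmaShift u g (g * sigma hu) := by
  intro r a ha
  change (g : V ≃ₗ[ℂ] V) (sigmaEquiv hu a) = _
  rw [sigmaEquiv_apply_of_mem hu ha, map_smul]

theorem IsSigmaShift.map_eq (hu : A.IsSemisimplePrimary u) (hgg : IsSigmaShift u g g')
    (hgu : (g : V ≃ₗ[ℂ] V) u = u) : (g' : V ≃ₗ[ℂ] V) u = u := by
  rw [hgg 0 u (mem_chargeSpace_zero hu)]
  simpa using hgu

/-- This symmetry lets the inverse construction land directly in `g`-twisted modules, with no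
transport along `gσ(u)σ(-u) = g`. -/
theorem IsSigmaShift.symm (hgg : IsSigmaShift u g g') : IsSigmaShift (-u) g' g := by
  intro r a ha
  rw [chargeSpace_neg] at ha
  rw [hgg _ a ha, smul_smul, ← Complex.exp_add]
  simp

variable {W : Type w} [AddCommGroup W] [Module ℂ W] (hu : A.IsRationalSemisimplePrimary u)

include hu in
/-- The homogeneous components of an eigenvector of `g σ(u)` are eigenvectors of `g`. -/
theorem IsSigmaShift.schur_chargeProj_eigen (hgg : IsSigmaShift u g g')
    (hgu : (g : V ≃ₗ[ℂ] V) u = u) {α : ℚ} {a : V}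
    (ha : (g' : V ≃ₗ[ℂ] V) a = Complex.exp (2 * Real.pi * Complex.I * (α : ℂ)) • a) (r : ℚ)
    (s : ℕ) :
    (g : V ≃ₗ[ℂ] V) (A.schur u s (chargeProj hu r a))
      = Complex.exp (2 * Real.pi * Complex.I * ((α + r : ℚ) : ℂ)) •
        A.schur u s (chargeProj hu r a) := by
  -- As `g'` fixes `u`, it preserves charges, so each charge component of `a` is again an
  -- eigenvector of `g'`.
  have h1 := map_chargeProj hu (hgg.map_eq hu.toIsSemisimplePrimary hgu) r a
  rw [ha, map_smul, hgg r _ (chargeProj_mem hu r a)] at h1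
  have h2 : (g : V ≃ₗ[ℂ] V) (chargeProj hu r a)
      = Complex.exp (2 * Real.pi * Complex.I * ((α + r : ℚ) : ℂ)) • chargeProj hu r a := by
    refine smul_right_injective V
      (Complex.exp_ne_zero (-(2 * Real.pi * Complex.I * (r : ℂ)))) ?_
    change _ • _ = _ • _
    rw [h1, smul_smul, ← Complex.exp_add]
    congr 2
    push_cast
    ring
  rw [hu.map_schur g hgu, h2, map_smul]

/-- The twisted module `(W, Y_W(Δ(u,z)·,z))`. -/
def WeakTwistedModule.delta (M : A.WeakTwistedModule g W) (hgu : (g : V ≃ₗ[ℂ] V) u = u)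
    (hgg : IsSigmaShift u g g') : A.WeakTwistedModule g' W where
  Y := deltaY hu M.Y
  mode_support α a ha n hn := by
    obtain ⟨S, hS⟩ := exists_eq_sum_chargeProj hu a
    rw [hS, map_sum, Finset.sum_apply]
    refine Finset.sum_eq_zero fun r _ => ?_
    obtain ⟨B, hB⟩ := hu.exists_schur_eq_zero (chargeProj hu r a)
    rw [deltaY_of_mem hu M.Y (chargeProj_mem hu r a) hB]
    refine Finset.sum_eq_zero fun s _ => ?_
    -- The eigenvalue and the mode index `n + r - s` are both shifted by `r`, so the condition `n ∈
    -- α + ℤ` is unaffected.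
    refine M.mode_support (α + r) _ (hgg.schur_chargeProj_eigen hu hgu ha r s) _ ?_
    rintro ⟨k, hk⟩
    refine hn ⟨k + s, ?_⟩
    push_cast
    linarith
  truncation := isTruncated_deltaY hu M.truncation
  vacuum_mode n := by rw [deltaY_vacuum, M.vacuum_mode]
  jacobi α a b ha l m n hm w := by
    change TwistedJacobi A (deltaY hu M.Y) a b l m n w
    have hT : IsTruncated (deltaY hu M.Y) := isTruncated_deltaY hu M.truncation
    obtain ⟨S, hS⟩ := exists_eq_sum_chargeProj hu a
    rw [hS]
    refine Finset.sum_induction _ (fun a => TwistedJacobi A (deltaY hu M.Y) a b l m n w)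
      (fun _ _ => TwistedJacobi.add_left hT) (TwistedJacobi.zero_left _ _ _ _ _ _) fun r _ => ?_
    refine charge_induction hu
      (P := fun b => TwistedJacobi A (deltaY hu M.Y) (chargeProj hu r a) b l m n w)
      (TwistedJacobi.zero_right _ _ _ _ _ _) (fun _ _ => TwistedJacobi.add_right hT)
      (fun ρ b hb => ?_) b
    refine twistedJacobi_deltaY_of_mem hu M.truncation (chargeProj_mem hu r a) hb l m n w
      fun j t => ?_
    obtain ⟨k, hk⟩ := hm
    refine M.jacobi (α + r) _ _ (hgg.schur_chargeProj_eigen hu hgu ha r j) l _ _ ⟨k - j, ?_⟩ w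
    rw [hk]
    push_cast
    ring

namespace IrreducibleTwistedModule

/-- The irreducible twisted module `(W, Y_W(Δ(u,z)·,z))`. -/
def delta (hgu : (g : V ≃ₗ[ℂ] V) u = u) (hgg : IsSigmaShift u g g')
    (M : IrreducibleTwistedModule.{v, w} A g) : IrreducibleTwistedModule.{v, w} A g' where
  carrier := M.carrier
  str := M.str.delta hu hgu hgg
  nontrivial := M.nontrivial
  irreducible S hS := M.irreducible S fun a n x hx => by
    -- The original modes are the transform by `-u` of the new ones, so a subspace stable under the
    -- latter is stable under the former.
    have h := deltaY_deltaY hu hu.neg (neg_neg u).symm M.str.Y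
    rw [← h]
    exact deltaY_mem hu.neg _ hS a n hx

variable (hgu : (g : V ≃ₗ[ℂ] V) u = u) (hgg : IsSigmaShift u g g')

theorem Iso.delta {M N : IrreducibleTwistedModule.{v, w} A g} (e : Iso M N) :
    Iso (M.delta hu hgu hgg) (N.delta hu hgu hgg) := by
  obtain ⟨f, hf⟩ := e
  exact ⟨f, deltaY_intertwine hu (h := 1) rfl f hf⟩

theorem IsStable.delta {h : A.aut} (hh : (h : V ≃ₗ[ℂ] V) u = u)
    {M : IrreducibleTwistedModule.{v, w} A g} (hM : M.IsStable h) :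
    (M.delta hu hgu hgg).IsStable h := by
  obtain ⟨f, hf⟩ := hM
  exact ⟨f, deltaY_intertwine hu hh f hf⟩

theorem iso_delta_delta {u' : V} (hu' : A.IsRationalSemisimplePrimary u') (h : u = -u')
    (hgu' : (g' : V ≃ₗ[ℂ] V) u' = u') (hgg' : IsSigmaShift u' g' g)
    (M : IrreducibleTwistedModule.{v, w} A g) :
    Iso ((M.delta hu hgu hgg).delta hu' hgu' hgg') M := by
  refine ⟨LinearEquiv.refl ℂ M.carrier, fun a n x => ?_⟩
  change deltaY hu' (deltaY hu M.str.Y) a n x = M.str.Y a n x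
  rw [deltaY_deltaY hu hu' h]

theorem isDeltaTransform_iff (M : IrreducibleTwistedModule.{v, w} A g)
    (N : IrreducibleTwistedModule.{v, w} A g') :
    M.IsDeltaTransform hu N ↔ Iso (M.delta hu hgu hgg) N := by
  refine exists_congr fun f => forall_congr' fun a => forall_congr' fun n =>
    forall_congr' fun x => ?_
  rw [← deltaY_apply hu M.str.Y a n x]
  exact eq_comm

end IrreducibleTwistedModule

variable (hgu : (g : V ≃ₗ[ℂ] V) u = u) (hgg : IsSigmaShift u g g')

/-- The map `(W, Y_W(·,z)) ↦ (W, Y_W(Δ(u,z)·,z))` on isomorphism classes. -/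
def IrrTwisted.delta : IrrTwisted.{v, w} A g → IrrTwisted.{v, w} A g' :=
  Quotient.map (IrreducibleTwistedModule.delta hu hgu hgg)
    fun _ _ e => IrreducibleTwistedModule.Iso.delta hu hgu hgg e

theorem IrrTwisted.IsStable.delta {h : A.aut} (hh : (h : V ≃ₗ[ℂ] V) u = u)
    {x : IrrTwisted.{v, w} A g} (hx : x.IsStable h) : (x.delta hu hgu hgg).IsStable h := by
  induction x using Quotient.inductionOn with
  | h M => exact IrreducibleTwistedModule.IsStable.delta hu hgu hgg hh hx

theorem IrrTwisted.delta_delta {u' : V} (hu' : A.IsRationalSemisimplePrimary u') (h : u = -u')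
    (hgu' : (g' : V ≃ₗ[ℂ] V) u' = u') (hgg' : IsSigmaShift u' g' g)
    (x : IrrTwisted.{v, w} A g) : (x.delta hu hgu hgg).delta hu' hgu' hgg' = x := by
  induction x using Quotient.inductionOn with
  | h M =>
    exact Quotient.sound
      (IrreducibleTwistedModule.iso_delta_delta hu hgu hgg hu' h hgu' hgg' M)

end Transform

/-! ### Finite order of σ(u), and its commutation with g. -/

section Order

theorem sigma_pow_apply (hu : A.IsRationalSemisimplePrimary u) {r : ℚ} {a : V}
    (ha : a ∈ A.chargeSpace u r) (n : ℕ) :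
    ((sigma hu ^ n : A.aut) : V ≃ₗ[ℂ] V) a
      = Complex.exp (-(2 * Real.pi * Complex.I * (r : ℂ))) ^ n • a := by
  induction n with
  | zero => simp
  | succ n ih =>
    rw [pow_succ]
    change ((sigma hu ^ n : A.aut) : V ≃ₗ[ℂ] V) (sigmaEquiv hu a) = _
    rw [sigmaEquiv_apply_of_mem hu ha, map_smul, ih, smul_smul, pow_succ']

theorem isOfFinOrder_sigma (hu : A.IsRationalSemisimplePrimary u) : IsOfFinOrder (sigma hu) := by
  obtain ⟨T, hT, h⟩ := hu.rational
  refine isOfFinOrder_iff_pow_eq_one.2 ⟨T.natAbs, Int.natAbs_pos.2 hT, ?_⟩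
  refine Subtype.ext (LinearEquiv.ext fun a => ?_)
  change ((sigma hu ^ T.natAbs : A.aut) : V ≃ₗ[ℂ] V) a = a
  refine charge_induction hu (P := fun a => ((sigma hu ^ T.natAbs : A.aut) : V ≃ₗ[ℂ] V) a = a)
    (by simp) (fun a b ha hb => by rw [map_add, ha, hb]) (fun r a ha => ?_) a
  -- Rationality concerns eigenvalues, so it constrains `r` only through a nonzero vector.
  by_cases ha0 : a = 0
  · simp [ha0]
  obtain ⟨k, hk⟩ := h (r : ℂ) (Module.End.hasEigenvalue_of_hasEigenvector ⟨ha, ha0⟩)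
  rw [sigma_pow_apply hu ha, ← Complex.exp_nat_mul, hk]
  have hT' : (T : ℂ) ≠ 0 := by exact_mod_cast hT
  have hexp : Complex.exp (T.natAbs * -(2 * Real.pi * Complex.I * ((k : ℂ) / T))) = 1 := by
    rw [Complex.exp_eq_one_iff]
    rcases Int.natAbs_eq T with h1 | h1
    · refine ⟨-k, ?_⟩
      have : ((T.natAbs : ℕ) : ℂ) = T := by
        conv_rhs => rw [h1]
        simp
      rw [this]
      push_cast
      field_simp
    · refine ⟨k, ?_⟩
      have : ((T.natAbs : ℕ) : ℂ) = -T := by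
        conv_rhs => rw [h1]
        simp
      rw [this]
      field_simp
  rw [hexp, one_smul]

theorem commute_sigma (hu : A.IsRationalSemisimplePrimary u) {g : A.aut}
    (hgu : (g : V ≃ₗ[ℂ] V) u = u) : Commute g (sigma hu) := by
  refine Subtype.ext (LinearEquiv.ext fun a => ?_)
  change (g : V ≃ₗ[ℂ] V) (sigmaEquiv hu a) = sigmaEquiv hu ((g : V ≃ₗ[ℂ] V) a)
  refine charge_induction hu
    (P := fun a => (g : V ≃ₗ[ℂ] V) (sigmaEquiv hu a) = sigmaEquiv hu ((g : V ≃ₗ[ℂ] V) a))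
    (by simp) (fun a b ha hb => by simp only [map_add, ha, hb]) (fun r a ha => ?_) a
  rw [sigmaEquiv_apply_of_mem hu ha, sigmaEquiv_apply_of_mem hu (map_mem_chargeSpace hgu ha),
    map_smul]

end Order

end VertexOperatorAlgebra

end

theorem mainTheorem10 {V : Type v} [AddCommGroup V] [Module ℂ V] (A : VertexOperatorAlgebra V)
    (u : V) (hu : A.IsRationalSemisimplePrimary u)
    (g : A.aut) (hg : IsOfFinOrder g) (hgu : (g : V ≃ₗ[ℂ] V) u = u) :
    IsOfFinOrder (g * VertexOperatorAlgebra.sigma hu) ∧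
    ∃ F : VertexOperatorAlgebra.IrrTwisted.{v, w} A g ≃
        VertexOperatorAlgebra.IrrTwisted.{v, w} A (g * VertexOperatorAlgebra.sigma hu),
      (∀ (M : VertexOperatorAlgebra.IrreducibleTwistedModule.{v, w} A g)
          (N : VertexOperatorAlgebra.IrreducibleTwistedModule.{v, w} A
            (g * VertexOperatorAlgebra.sigma hu)),
        F M.isoClass = N.isoClass ↔ M.IsDeltaTransform hu N) ∧
      ∀ h : A.aut, Commute h g → (h : V ≃ₗ[ℂ] V) u = u →
        Set.BijOn F {x | x.IsStable h} {y | y.IsStable h} := by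
  open VertexOperatorAlgebra in
  have hgg := isSigmaShift_mul_sigma hu g
  have hgu' : ((g * sigma hu : A.aut) : V ≃ₗ[ℂ] V) (-u) = -u := by
    rw [map_neg, hgg.map_eq hu.toIsSemisimplePrimary hgu]
  let F : IrrTwisted.{v, w} A g ≃ IrrTwisted.{v, w} A (g * sigma hu) :=
    { toFun := IrrTwisted.delta hu hgu hgg
      invFun := IrrTwisted.delta hu.neg hgu' hgg.symm
      left_inv := IrrTwisted.delta_delta hu hgu hgg hu.neg (neg_neg u).symm hgu' hgg.symm
      right_inv := IrrTwisted.delta_delta hu.neg hgu' hgg.symm hu rfl hgu hgg }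
  refine ⟨(commute_sigma hu hgu).isOfFinOrder_mul hg (isOfFinOrder_sigma hu), F,
    fun M N => ?_, fun h _ hhu => F.bijOn fun x => ⟨fun hx => ?_, fun hx => ?_⟩⟩
  · rw [IrreducibleTwistedModule.isDeltaTransform_iff hu hgu hgg]
    exact Quotient.eq
  -- Stability is pulled back by applying the inverse transform, since `h` also fixes `-u`.
  · have := IrrTwisted.IsStable.delta hu.neg hgu' hgg.symm (h := h) (by rw [map_neg, hhu]) hx
    have h2 : (F x).delta hu.neg hgu' hgg.symm = x := F.left_inv x
    rwa [h2] at this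
  · exact IrrTwisted.IsStable.delta hu hgu hgg hhu hx
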